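/- Let $\theta>0$. The \emph{Hoppe tree} with parameter $\theta$ has root $0$, and the parents $J_1,J_2,\dots$ of the vertices $1,2,\dots$ are independent random variables with $$P(J_n=0)=\frac{\theta}{\theta+n-1},\qquad P(J_n=k)=\frac{1}{\theta+n-1}\quad(1\le k\le n-1);$$ for $\theta=1$ it is the random recursive tree. In the subtree on $\{0,\dots,n-1\}$ let $D_k$ be the distance of $k$ from the root, let $D_{ik}$ be the distance from the root to the last common vertex of the paths from the root to $i$ and to $k$, let $T_n=\sum_{k=0}^{n-1}D_k$ be the total length, let $W_n$ be the Wiener index (the sum of the distances over all unordered pairs of distinct vertices), and let $U_n=T_n+2\sum_{0\le i<k\le n-1}D_{ik}$. Write $U_n'$ for $U_n$ in the Hoppe tree with parameter $\theta$. Then $U_n=nT_n-W_n$ for every such tree, and the following hold. (a) In the random recursive tree ($\theta=1$), $U_n/n^2$ converges in distribution to a random variable $U$ that satisfies $U\overset{d}{=}V_0^2U^*+(1-V_0)^2U+V_0^2$, where $U,U^*,V_0$ are independent, $U^*\overset{d}{=}U$ and $V_0$ is uniform on $[0,1]$; moreover $\mathbb E U=1$ and $\mathbb E U^2=\frac{11}{9}$.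 (b) For every $\theta>0$, $U_n'/n^2$ converges in distribution to a random variable $U'$ that satisfies $$U'\overset{d}{=}(1-V)^2U'+V^2U+V^2,$$ where $U',V,U$ are independent, $V\sim\mathrm{Beta}(1,\theta)$ and $U$ has the law of the limit in (a). Moreover $$\mathbb E U'=\frac{2}{1+\theta},\qquad \mathbb E U'^2=\frac{12\theta+76}{3(1+\theta)(2+\theta)(3+\theta)}.$$ (c) Let $\sigma>0$ and let $(X_n)_{n\ge0}$ be the random recursive set in $\mathbb R$ with normal jumps: $X_0=0$ and, for $n\ge1$, $J_n$ is independent of $(X_0,\dots,X_{n-1},J_1,\dots,J_{n-1})$ and the conditional law of $X_n$ given $X_0,\dots,X_{n-1},J_1,\dots,J_n$ is $N(X_{J_n},\sigma^2)$. Then the barycentre $S_n=\frac1n\sum_{k=0}^{n-1}X_k$ converges in distribution to the mixed centred normal law $\int N(0,v)\,\rho(dv)$, where the law $\rho$ of the random variance is the law of $\sigma^2U'$. It is concentrated on $[0,\infty)$ and has expectation $\frac{2}{1+\theta}\sigma^2$ and variance $\frac{28\theta+4}{3(1+\theta)^2(2+\theta)(3+\theta)}\sigma^4$. -/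

import Mathlib

open MeasureTheory ProbabilityTheory Filter
open scoped NNReal

universe u

noncomputable section

namespace HoppeTree

/-! ### Recursive trees

A recursive tree on the vertices `0, 1, 2, …` with root `0` is given by its parent function:
`j m : Fin (m + 1)` is the parent of the vertex `m + 1`. Its first `n` vertices `0, …, n - 1`
span a tree which is determined by `j 0, …, j (n - 2)`. -/

/-- A choice of a parent in `{0, …, m}` for every vertex `m + 1`. -/
abbrev Parents : Type := (m : ℕ) → Fin (m + 1)

/-- The vertices of the path from the root `0` to the vertex `k`, both included. -/
def path (j : Parents) : ℕ → Finset ℕ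
  | 0 => {0}
  | m + 1 => insert (m + 1) (path j (j m).val)
termination_by k => k
decreasing_by exact (j m).isLt

/-- `D_k`: the number of steps from the root `0` to the vertex `k`. -/
def depth (j : Parents) : ℕ → ℕ
  | 0 => 0
  | m + 1 => depth j (j m).val + 1
termination_by k => k
decreasing_by exact (j m).isLt

/-- The last common vertex of the paths from the root to `i` and to `k`. Paths are increasing and
all contain `0`, so this is the largest common vertex. -/
def lastCommon (j : Parents) (i k : ℕ) : ℕ := (path j i ∩ path j k).sup id

/-- `D_{ik}`: the distance to the root of the last common vertex of the paths to `i` and `k`. -/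
def commonDepth (j : Parents) (i k : ℕ) : ℕ := depth j (lastCommon j i k)

/-- `T_n`: the total length of the tree on the vertices `0, …, n - 1`. -/
def totalLength (j : Parents) (n : ℕ) : ℕ := ∑ k ∈ Finset.range n, depth j k

/-- `R_n`: the sum of `D_{ik}` over `0 ≤ i < k ≤ n - 1`. -/
def commonLength (j : Parents) (n : ℕ) : ℕ :=
  ∑ k ∈ Finset.range n, ∑ i ∈ Finset.range k, commonDepth j i k

/-- `U_n = T_n + 2 R_n`. -/
def pathSum (j : Parents) (n : ℕ) : ℕ := totalLength j n + 2 * commonLength j n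

/-- The tree on the vertices `0, …, n - 1` as a graph: the edges join each vertex `m + 1` to its
parent `j m`. -/
def tree (j : Parents) (n : ℕ) : SimpleGraph (Fin n) :=
  SimpleGraph.fromRel fun a b => ∃ m : ℕ, b.val = m + 1 ∧ a.val = (j m).val

/-- `W_n`: the Wiener index, the sum of the graph distances over all unordered pairs of distinct
vertices. -/
def wienerIndex (j : Parents) (n : ℕ) : ℕ :=
  ∑ p : Fin n × Fin n with p.1 < p.2, (tree j n).dist p.1 p.2

/-! ### The random Hoppe tree -/

/-- `J m` (the parent of the vertex `m + 1`), `m = 0, 1, …`, are independent; the vertex `m + 1`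
chooses the root `0` with probability `θ / (θ + m)` and each of the vertices `1, …, m` with
probability `1 / (θ + m)`. For `θ = 1` this is the random recursive tree. -/
structure IsHoppe {Ω : Type*} [MeasurableSpace Ω] (θ : ℝ) (J : (m : ℕ) → Ω → Fin (m + 1))
    (P : Measure Ω) : Prop where
  measurable : ∀ m, Measurable (J m)
  indep : iIndepFun J P
  prob_root : ∀ m, P.real {ω | J m ω = 0} = θ / (θ + m)
  prob_vertex : ∀ m, ∀ k : Fin (m + 1), k ≠ 0 → P.real {ω | J m ω = k} = 1 / (θ + m)

/-! ### The random recursive set -/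

/-- The σ-algebra generated by `X 0, …, X n` and by the parents of the vertices `1, …, n`. -/
abbrev history {Ω : Type*} (J : (m : ℕ) → Ω → Fin (m + 1)) (X : ℕ → Ω → ℝ) (n : ℕ) :
    MeasurableSpace Ω :=
  (⨆ i ∈ Set.Iic n, MeasurableSpace.comap (X i) inferInstance) ⊔
    ⨆ m ∈ Set.Iio n, MeasurableSpace.comap (J m) inferInstance

/-- The random recursive set `X 0, X 1, …` in `ℝ` with jump kernel `κ`: it starts at `X 0 = 0`;
given the history up to `X n`, the vertex `n + 1` picks its parent `J n` by the Hoppe rule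
independently of that history, and then `X (n + 1)` has the conditional distribution
`κ (X (J n), ·)`. -/
structure IsRecursiveSet {Ω : Type*} [MeasurableSpace Ω] (θ : ℝ) (κ : Kernel ℝ ℝ)
    (J : (m : ℕ) → Ω → Fin (m + 1)) (X : ℕ → Ω → ℝ) (P : Measure Ω) : Prop where
  isHoppe : IsHoppe θ J P
  measurable : ∀ n, Measurable (X n)
  zero : ∀ᵐ ω ∂P, X 0 ω = 0
  indep : ∀ n, Indep (MeasurableSpace.comap (J n) inferInstance) (history J X n) P
  condDistrib : ∀ n, ∀ B : Set ℝ, MeasurableSet B →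
    P⟦X (n + 1) ⁻¹' B | history J X n ⊔ MeasurableSpace.comap (J n) inferInstance⟧
      =ᵐ[P] fun ω => (κ (X (J n ω).val ω)).real B

/-- The barycentre `S_n` of `X 0, …, X (n - 1)`. -/
def barycentre {Ω : Type*} (X : ℕ → Ω → ℝ) (n : ℕ) (ω : Ω) : ℝ :=
  (∑ k ∈ Finset.range n, X k ω) / n

/-- The normal kernel `κ (x, ·) = N(x, σ²)`. -/
def normalKernel (σ : ℝ≥0) : Kernel ℝ ℝ where
  toFun x := gaussianReal x (σ ^ 2)
  measurable' := measurable_gaussianReal.comp (measurable_id.prodMk measurable_const)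

/-- The kernel `v ↦ N(0, v)`, meant for variances `v ≥ 0`. -/
def centredNormalKernel : Kernel ℝ ℝ where
  toFun v := gaussianReal 0 v.toNNReal
  measurable' := measurable_gaussianReal.comp (measurable_const.prodMk measurable_real_toNNReal)

instance : IsMarkovKernel centredNormalKernel :=
  ⟨fun v => inferInstanceAs (IsProbabilityMeasure (gaussianReal 0 v.toNNReal))⟩

/-- The mixed centred normal distribution `∫ N(0, v) ρ(dv)` whose random variance has law `ρ`. -/
def mixedNormal (ρ : Measure ℝ) : Measure ℝ := centredNormalKernel ∘ₘ ρ

instance (ρ : Measure ℝ) [IsProbabilityMeasure ρ] : IsProbabilityMeasure (mixedNormal ρ) :=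
  inferInstanceAs (IsProbabilityMeasure (centredNormalKernel ∘ₘ ρ))

/-! ### The fixed point equations -/

/-- `μ` is the law of some `U` with `U =d V² U* + (1 - V)² U + V²`, where `U`, `U*`, `V` are
independent, `U* =d U` and `V` is uniform on `[0, 1]`. -/
def IsRecursiveFixpoint (μ : Measure ℝ) : Prop :=
  μ = (μ.prod (μ.prod (volume.restrict (Set.Icc (0 : ℝ) 1)))).map
    fun p => p.2.2 ^ 2 * p.1 + (1 - p.2.2) ^ 2 * p.2.1 + p.2.2 ^ 2

/-- `μ'` is the law of some `U'` with `U' =d (1 - V)² U' + V² U + V²`, where `U'`, `U`, `V` are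
independent, `U` has law `μ` and `V` has the distribution Beta(1, θ). -/
def IsHoppeFixpoint (θ : ℝ) (μ μ' : Measure ℝ) : Prop :=
  μ' = (μ'.prod (μ.prod (betaMeasure 1 θ))).map
    fun p => (1 - p.2.2) ^ 2 * p.1 + p.2.2 ^ 2 * p.2.1 + p.2.2 ^ 2

end HoppeTree

end

noncomputable section

namespace HoppeTree

section Combinatorics

variable (j : Parents)

lemma path_zero : path j 0 = {0} := by rw [path]

lemma path_succ (m : ℕ) : path j (m + 1) = insert (m + 1) (path j (j m)) := by rw [path]

lemma depth_zero : depth j 0 = 0 := by rw [depth]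

lemma depth_succ (m : ℕ) : depth j (m + 1) = depth j (j m) + 1 := by rw [depth]

lemma le_of_mem_path {k a : ℕ} (h : a ∈ path j k) : a ≤ k := by
  induction k using Nat.strong_induction_on generalizing a with
  | _ k ih =>
    cases k with
    | zero => simpa [path_zero] using h
    | succ m =>
      rw [path_succ, Finset.mem_insert] at h
      rcases h with rfl | h
      · exact le_rfl
      · exact (ih _ (j m).isLt h).trans (j m).isLt.le

lemma self_mem_path (k : ℕ) : k ∈ path j k := by
  cases k with
  | zero => simp [path_zero]
  | succ m => simp [path_succ]

lemma notMem_path_of_lt {k a : ℕ} (h : k < a) : a ∉ path j k :=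
  fun ha => (le_of_mem_path j ha).not_gt h

lemma card_path (k : ℕ) : (path j k).card = depth j k + 1 := by
  induction k using Nat.strong_induction_on with
  | _ k ih =>
    cases k with
    | zero => simp [path_zero, depth_zero]
    | succ m =>
      rw [path_succ, Finset.card_insert_of_notMem (notMem_path_of_lt j (j m).isLt),
        ih _ (j m).isLt, depth_succ]

lemma commonDepth_comm (a b : ℕ) : commonDepth j a b = commonDepth j b a := by
  rw [commonDepth, commonDepth, lastCommon, lastCommon, Finset.inter_comm]

lemma commonDepth_self (a : ℕ) : commonDepth j a a = depth j a := by
  rw [commonDepth, lastCommon, Finset.inter_self]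
  congr 1
  exact le_antisymm (Finset.sup_le fun b hb => le_of_mem_path j hb)
    (Finset.le_sup (f := id) (self_mem_path j a))

lemma path_inter_path_succ {a m : ℕ} (h : a ≤ m) :
    path j a ∩ path j (m + 1) = path j a ∩ path j (j m) := by
  rw [path_succ, Finset.inter_insert_of_notMem (notMem_path_of_lt j (Nat.lt_succ_of_le h))]

lemma commonDepth_succ {a m : ℕ} (h : a ≤ m) :
    commonDepth j a (m + 1) = commonDepth j a (j m) := by
  rw [commonDepth, commonDepth, lastCommon, lastCommon, path_inter_path_succ j h]

/-- Induction on pairs of vertices, descending from the larger one to its parent. -/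
lemma pair_induction {Q : ℕ → ℕ → Prop} (symm : ∀ a b, Q a b → Q b a) (diag : ∀ a, Q a a)
    (step : ∀ a m, a ≤ m → Q a (j m) → Q a (m + 1)) (a b : ℕ) : Q a b := by
  have key : ∀ s a b, a + b = s → Q a b := by
    intro s
    induction s using Nat.strong_induction_on with
    | _ s ih =>
      have aux : ∀ a b, a + b = s → a < b → Q a b := by
        intro a b hs hab
        obtain ⟨m, rfl⟩ : ∃ m, b = m + 1 := ⟨b - 1, by omega⟩
        exact step a m (by omega) (ih _ (by have := (j m).isLt; omega) a _ rfl)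
      intro a b hs
      rcases lt_trichotomy a b with h | rfl | h
      · exact aux a b hs h
      · exact diag a
      · exact symm _ _ (aux b a (by omega) h)
  exact key _ a b rfl

lemma card_path_inter (a b : ℕ) : (path j a ∩ path j b).card = commonDepth j a b + 1 := by
  induction a, b using pair_induction j with
  | symm a b h => rw [Finset.inter_comm, h, commonDepth_comm]
  | diag a => rw [Finset.inter_self, card_path, commonDepth_self]
  | step a m h ih => rw [path_inter_path_succ j h, ih, commonDepth_succ j h]

lemma commonDepth_le_right (a b : ℕ) : commonDepth j a b ≤ depth j b := by
  have := Finset.card_le_card (Finset.inter_subset_right (s₁ := path j a) (s₂ := path j b))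
  rw [card_path_inter, card_path] at this
  omega

lemma commonDepth_zero_right (a : ℕ) : commonDepth j a 0 = 0 := by
  have := commonDepth_le_right j a 0
  rw [depth_zero] at this
  omega

/-- `U_n` is the sum of `D_{ik}` over all ordered pairs. -/
lemma pathSum_eq_sum (n : ℕ) : pathSum j n =
    ∑ i ∈ Finset.range n, ∑ k ∈ Finset.range n, commonDepth j i k := by
  induction n with
  | zero => simp [pathSum, totalLength, commonLength]
  | succ n ih =>
    have e : pathSum j (n + 1) =
        pathSum j n + depth j n + 2 * ∑ i ∈ Finset.range n, commonDepth j i n := by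
      simp only [pathSum, totalLength, commonLength, Finset.sum_range_succ]
      ring
    rw [e, ih]
    simp only [Finset.sum_range_succ, Finset.sum_add_distrib, commonDepth_self,
      commonDepth_comm j n]
    ring

lemma pathSum_one : pathSum j 1 = 0 := by simp [pathSum_eq_sum, commonDepth_zero_right]

lemma totalLength_one : totalLength j 1 = 0 := by simp [totalLength, depth_zero]

lemma totalLength_add_two (m : ℕ) :
    totalLength j (m + 2) = totalLength j (m + 1) + (depth j (j m) + 1) := by
  rw [totalLength, Finset.sum_range_succ, depth_succ]; rfl

lemma pathSum_add_two (m : ℕ) : pathSum j (m + 2) = pathSum j (m + 1) +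
    2 * ∑ i ∈ Finset.range (m + 1), commonDepth j i (j m) + depth j (j m) + 1 := by
  have h : ∑ i ∈ Finset.range (m + 1), commonDepth j i (m + 1) =
      ∑ i ∈ Finset.range (m + 1), commonDepth j i (j m) :=
    Finset.sum_congr rfl fun i hi => commonDepth_succ j (by simpa [Nat.lt_succ_iff] using hi)
  rw [← h, pathSum_eq_sum, pathSum_eq_sum, Finset.sum_range_succ]
  simp only [Finset.sum_range_succ _ (m + 1), Finset.sum_add_distrib, commonDepth_self,
    commonDepth_comm j (m + 1), depth_succ j m]
  ring

/-! ### Dependence on finitely many parents -/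

variable {j} {j' : Parents}

lemma path_congr {n : ℕ} (h : ∀ m < n, j m = j' m) {k : ℕ} (hk : k ≤ n) :
    path j k = path j' k := by
  induction k using Nat.strong_induction_on with
  | _ k ih =>
    cases k with
    | zero => simp [path_zero]
    | succ m =>
      rw [path_succ, path_succ, ← h m (by omega), ih _ (j m).isLt (by have := (j m).isLt; omega)]

lemma depth_congr {n : ℕ} (h : ∀ m < n, j m = j' m) {k : ℕ} (hk : k ≤ n) :
    depth j k = depth j' k := by
  have := card_path j k
  rw [path_congr h hk, card_path] at this
  omega

lemma commonDepth_congr {n : ℕ} (h : ∀ m < n, j m = j' m) {i k : ℕ} (hi : i ≤ n) (hk : k ≤ n) :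
    commonDepth j i k = commonDepth j' i k := by
  have := card_path_inter j i k
  rw [path_congr h hi, path_congr h hk, card_path_inter] at this
  omega

lemma totalLength_congr {n : ℕ} (h : ∀ m < n, j m = j' m) :
    totalLength j (n + 1) = totalLength j' (n + 1) :=
  Finset.sum_congr rfl fun k hk => depth_congr h (by simpa [Nat.lt_succ_iff] using hk)

lemma pathSum_congr {n : ℕ} (h : ∀ m < n, j m = j' m) :
    pathSum j (n + 1) = pathSum j' (n + 1) := by
  rw [pathSum_eq_sum, pathSum_eq_sum]
  refine Finset.sum_congr rfl fun i hi => Finset.sum_congr rfl fun k hk => ?_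
  exact commonDepth_congr h (by simpa [Nat.lt_succ_iff] using hi)
    (by simpa [Nat.lt_succ_iff] using hk)

end Combinatorics

section Wiener

variable (j : Parents)

/-- The number of vertices that lie on exactly one of the paths from the root to `a` and `b`. -/
def pathDist (a b : ℕ) : ℕ := (symmDiff (path j a) (path j b)).card

lemma pathDist_self (a : ℕ) : pathDist j a a = 0 := by simp [pathDist]

lemma pathDist_comm (a b : ℕ) : pathDist j a b = pathDist j b a := by
  rw [pathDist, pathDist, symmDiff_comm]

lemma pathDist_triangle (a b c : ℕ) : pathDist j a c ≤ pathDist j a b + pathDist j b c :=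
  (Finset.card_le_card (symmDiff_triangle (path j a) (path j b) (path j c))).trans
    (Finset.card_union_le _ _)

lemma pathDist_succ {a m : ℕ} (h : a ≤ m) : pathDist j a (m + 1) = pathDist j a (j m) + 1 := by
  have h1 := notMem_path_of_lt j (Nat.lt_succ_of_le h)
  have h2 := notMem_path_of_lt j (j m).isLt
  rw [pathDist, pathDist, path_succ, ← Finset.card_insert_of_notMem (a := m + 1)]
  · congr 1
    ext x
    simp only [Finset.mem_symmDiff, Finset.mem_insert]
    by_cases hx : x = m + 1
    · subst hx; simp [h1]
    · simp [hx]
  · simp [Finset.mem_symmDiff, h1, h2]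

lemma pathDist_parent (m : ℕ) : pathDist j (j m) (m + 1) = 1 := by
  rw [pathDist_succ j (Nat.lt_succ_iff.mp (j m).isLt), pathDist_self]

lemma pathDist_add (a b : ℕ) :
    pathDist j a b + 2 * commonDepth j a b = depth j a + depth j b := by
  induction a, b using pair_induction j with
  | symm a b h => rw [pathDist_comm, commonDepth_comm, h, add_comm]
  | diag a => rw [pathDist_self, commonDepth_self]; ring
  | step a m h ih =>
    rw [pathDist_succ j h, commonDepth_succ j h, depth_succ]
    omega

lemma pathDist_le_one_of_adj {n : ℕ} {a b : Fin n} (h : (tree j n).Adj a b) :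
    pathDist j a b ≤ 1 := by
  rw [tree, SimpleGraph.fromRel_adj] at h
  obtain ⟨-, ⟨m, hb, ha⟩ | ⟨m, hb, ha⟩⟩ := h
  · rw [ha, hb, pathDist_parent]
  · rw [ha, hb, pathDist_comm, pathDist_parent]

lemma pathDist_le_length {n : ℕ} {a b : Fin n} (p : (tree j n).Walk a b) :
    pathDist j a b ≤ p.length := by
  induction p with
  | nil => simp [pathDist_self]
  | @cons x y z h p ih =>
    have h1 := pathDist_triangle j x y z
    have h2 := pathDist_le_one_of_adj j h
    rw [SimpleGraph.Walk.length_cons]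
    omega

lemma exists_walk_length_eq (n : ℕ) (a b : ℕ) : ∀ (ha : a < n) (hb : b < n),
    ∃ p : (tree j n).Walk ⟨a, ha⟩ ⟨b, hb⟩, p.length = pathDist j a b := by
  induction a, b using pair_induction j with
  | symm a b h =>
    intro ha hb
    obtain ⟨p, hp⟩ := h hb ha
    exact ⟨p.reverse, by rw [SimpleGraph.Walk.length_reverse, hp, pathDist_comm]⟩
  | diag a => exact fun ha _ => ⟨SimpleGraph.Walk.nil, by simp [pathDist_self]⟩
  | step a m h ih =>
    intro ha hb
    have hm : (j m : ℕ) < n := (j m).isLt.trans_le hb.le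
    obtain ⟨p, hp⟩ := ih ha hm
    have hadj : (tree j n).Adj ⟨j m, hm⟩ ⟨m + 1, hb⟩ := by
      rw [tree, SimpleGraph.fromRel_adj]
      refine ⟨fun e => ?_, Or.inl ⟨m, rfl, rfl⟩⟩
      have := (j m).isLt
      simp only [Fin.mk.injEq] at e
      omega
    exact ⟨p.concat hadj, by rw [SimpleGraph.Walk.length_concat, hp, pathDist_succ j h]⟩

lemma dist_tree {n : ℕ} (a b : Fin n) : (tree j n).dist a b = pathDist j a b := by
  obtain ⟨p, hp⟩ := exists_walk_length_eq j n a b a.isLt b.isLt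
  obtain ⟨q, hq⟩ := SimpleGraph.Reachable.exists_walk_length_eq_dist ⟨p⟩
  refine le_antisymm (hp ▸ SimpleGraph.dist_le p) ?_
  exact (pathDist_le_length j q).trans_eq hq

lemma wienerIndex_eq_sum (n : ℕ) : wienerIndex j n =
    ∑ k ∈ Finset.range n, ∑ i ∈ Finset.range k, pathDist j i k := by
  rw [wienerIndex, Finset.sum_filter, Fintype.sum_prod_type_right]
  rw [Finset.sum_range (f := fun k => ∑ i ∈ Finset.range k, pathDist j i k)]
  refine Finset.sum_congr rfl fun k _ => ?_
  have h1 : ∀ i : Fin n, (if i < k then (tree j n).dist i k else 0) =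
      (fun i : ℕ => if i < (k : ℕ) then pathDist j i k else 0) i := by
    intro i
    simp only [dist_tree, Fin.lt_def]
  simp only [h1]
  rw [← Finset.sum_range (f := fun i : ℕ => if i < (k : ℕ) then pathDist j i k else 0),
    ← Finset.sum_filter]
  congr 1
  ext i
  simp only [Finset.mem_filter, Finset.mem_range]
  have := k.isLt
  omega

lemma pathSum_add_wienerIndex (n : ℕ) :
    pathSum j n + wienerIndex j n = n * totalLength j n := by
  rw [wienerIndex_eq_sum, pathSum]
  induction n with
  | zero => simp [totalLength, commonLength]
  | succ n ih =>
    have h : ∑ i ∈ Finset.range n, pathDist j i n + 2 * ∑ i ∈ Finset.range n, commonDepth j i n =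
        totalLength j n + n * depth j n := by
      rw [Finset.mul_sum, ← Finset.sum_add_distrib,
        Finset.sum_congr rfl fun i _ => pathDist_add j i n, Finset.sum_add_distrib, totalLength]
      simp
    have hT : totalLength j (n + 1) = totalLength j n + depth j n := by
      simp [totalLength, Finset.sum_range_succ]
    have hR : commonLength j (n + 1) =
        commonLength j n + ∑ i ∈ Finset.range n, commonDepth j i n := by
      simp [commonLength, Finset.sum_range_succ]
    rw [Finset.sum_range_succ, hT, hR]
    linarith

end Wiener

section Canonical

/-- The probability that the vertex `m + 1` chooses the parent `k`. -/
def parentWeight (θ : ℝ) (m : ℕ) (k : Fin (m + 1)) : ℝ := if k = 0 then θ / (θ + m) else 1 / (θ + m)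

lemma parentWeight_nonneg {θ : ℝ} (hθ : 0 < θ) (m : ℕ) (k : Fin (m + 1)) :
    0 ≤ parentWeight θ m k := by
  unfold parentWeight; split_ifs <;> positivity

lemma sum_parentWeight {θ : ℝ} (hθ : 0 < θ) (m : ℕ) : ∑ k, parentWeight θ m k = 1 := by
  have : θ + m ≠ 0 := by positivity
  rw [Fin.sum_univ_succ]
  simp [parentWeight, Fin.succ_ne_zero]
  field_simp

/-- The law of the parent of the vertex `m + 1`. -/
def parentLaw (θ : ℝ) (m : ℕ) : Measure (Fin (m + 1)) :=
  ∑ k, ENNReal.ofReal (parentWeight θ m k) • Measure.dirac k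

lemma parentLaw_singleton (θ : ℝ) (m : ℕ) (k : Fin (m + 1)) :
    parentLaw θ m {k} = ENNReal.ofReal (parentWeight θ m k) := by
  simp [parentLaw, Measure.finsetSum_apply, Set.indicator_apply]

lemma isProbabilityMeasure_parentLaw {θ : ℝ} (hθ : 0 < θ) (m : ℕ) :
    IsProbabilityMeasure (parentLaw θ m) := by
  constructor
  simp only [parentLaw, Measure.finsetSum_apply, Measure.smul_apply, measure_univ, smul_eq_mul,
    mul_one]
  rw [← ENNReal.ofReal_sum_of_nonneg fun k _ => parentWeight_nonneg hθ m k, sum_parentWeight hθ,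
    ENNReal.ofReal_one]

lemma integral_parentLaw {E : Type*} [NormedAddCommGroup E] [NormedSpace ℝ E] [CompleteSpace E]
    {θ : ℝ} (hθ : 0 < θ) (m : ℕ) (f : Fin (m + 1) → E) :
    ∫ k, f k ∂parentLaw θ m = ∑ k, parentWeight θ m k • f k := by
  have := isProbabilityMeasure_parentLaw hθ m
  rw [integral_fintype (.of_finite)]
  refine Finset.sum_congr rfl fun k _ => ?_
  rw [measureReal_def, parentLaw_singleton, ENNReal.toReal_ofReal (parentWeight_nonneg hθ m k)]

/-- The law of the sequence of the parents in the Hoppe tree. -/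
def hoppeMeasure (θ : ℝ) : Measure Parents := Measure.infinitePi (parentLaw θ)

lemma isProbabilityMeasure_hoppeMeasure {θ : ℝ} (hθ : 0 < θ) :
    IsProbabilityMeasure (hoppeMeasure θ) := by
  have := isProbabilityMeasure_parentLaw hθ
  unfold hoppeMeasure
  infer_instance

lemma IsHoppe.map_eq {Ω : Type*} [MeasurableSpace Ω] {θ : ℝ}
    {J : (m : ℕ) → Ω → Fin (m + 1)} {P : Measure Ω} [IsProbabilityMeasure P]
    (h : IsHoppe θ J P) : P.map (fun ω m => J m ω) = hoppeMeasure θ := by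
  rw [h.indep.map_fun_eq_infinitePi_map h.measurable, hoppeMeasure]
  congr 1
  funext m
  refine Measure.ext_of_singleton fun k => ?_
  rw [Measure.map_apply (h.measurable m) (measurableSet_singleton k), parentLaw_singleton]
  have e : P.real (J m ⁻¹' {k}) = parentWeight θ m k := by
    unfold parentWeight
    split_ifs with hk
    · rw [hk, ← h.prob_root m]; rfl
    · rw [← h.prob_vertex m k hk]; rfl
  rw [← e, measureReal_def, ENNReal.ofReal_toReal (measure_ne_top _ _)]

lemma IsHoppe.measurable_parents {Ω : Type*} [MeasurableSpace Ω] {θ : ℝ}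
    {J : (m : ℕ) → Ω → Fin (m + 1)} {P : Measure Ω} (h : IsHoppe θ J P) :
    Measurable fun ω m => J m ω :=
  measurable_pi_iff.mpr h.measurable

/-- The parents of the vertices `m + 1` with `m ∈ s`, completed by the root. -/
def extend (s : Finset ℕ) (y : (i : s) → Fin ((i : ℕ) + 1)) : Parents :=
  fun i => if h : i ∈ s then y ⟨i, h⟩ else 0

lemma extend_restrict {β : Type*} {m : ℕ} {f : Parents → β} (hf : DependsOn f (Set.Iio m))
    (j : Parents) : f (extend (Finset.range m) ((Finset.range m).restrict j)) = f j :=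
  hf fun i hi => by simp only [Set.mem_Iio] at hi; simp [extend, hi]

lemma measurable_of_dependsOn {β : Type*} [MeasurableSpace β] {m : ℕ} {f : Parents → β}
    (hf : DependsOn f (Set.Iio m)) : Measurable f := by
  have : f = (fun y => f (extend (Finset.range m) y)) ∘ (Finset.range m).restrict :=
    funext fun j => (extend_restrict hf j).symm
  rw [this]
  exact (measurable_of_countable _).comp (Finset.measurable_restrict _)

lemma aestronglyMeasurable_of_dependsOn {E : Type*} [NormedAddCommGroup E]
    {m : ℕ} {f : Parents → E}
    (hf : DependsOn f (Set.Iio m)) (μ : Measure Parents) : AEStronglyMeasurable f μ := by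
  have : f = (fun y => f (extend (Finset.range m) y)) ∘ (Finset.range m).restrict :=
    funext fun j => (extend_restrict hf j).symm
  rw [this]
  exact (StronglyMeasurable.of_discrete.comp_measurable
    (Finset.measurable_restrict _)).aestronglyMeasurable

lemma exists_bound_of_dependsOn {E : Type*} [NormedAddCommGroup E] {m : ℕ} {f : Parents → E}
    (hf : DependsOn f (Set.Iio m)) : ∃ C, ∀ j, ‖f j‖ ≤ C := by
  obtain ⟨C, hC⟩ := (Set.finite_range fun y => ‖f (extend (Finset.range m) y)‖).bddAbove
  exact ⟨C, fun j => hC ⟨(Finset.range m).restrict j, by simp only [extend_restrict hf]⟩⟩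

lemma memLp_of_dependsOn {E : Type*} [NormedAddCommGroup E] {m : ℕ} {f : Parents → E}
    (hf : DependsOn f (Set.Iio m)) (μ : Measure Parents) [IsFiniteMeasure μ] (p : ENNReal) :
    MemLp f p μ := by
  obtain ⟨C, hC⟩ := exists_bound_of_dependsOn hf
  exact MemLp.of_bound (aestronglyMeasurable_of_dependsOn hf μ) C (ae_of_all _ hC)

lemma integrable_of_dependsOn {E : Type*} [NormedAddCommGroup E] {m : ℕ} {f : Parents → E}
    (hf : DependsOn f (Set.Iio m)) (μ : Measure Parents) [IsFiniteMeasure μ] : Integrable f μ :=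
  memLp_one_iff_integrable.mp (memLp_of_dependsOn hf μ 1)

/-- Averaging over the parent of the vertex `m + 1`, which is independent of the past. -/
lemma integral_parent {E : Type*} [NormedAddCommGroup E] [NormedSpace ℝ E] [CompleteSpace E]
    {θ : ℝ} (hθ : 0 < θ) {m : ℕ} {f : Parents → Fin (m + 1) → E}
    (hf : DependsOn f (Set.Iio m)) :
    ∫ j, f j (j m) ∂hoppeMeasure θ =
      ∫ j, ∑ p, parentWeight θ m p • f j p ∂hoppeMeasure θ := by
  have := isProbabilityMeasure_hoppeMeasure hθ
  have := isProbabilityMeasure_parentLaw hθ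
  have hind : iIndepFun (fun (i : ℕ) (j : Parents) => j i) (hoppeMeasure θ) :=
    iIndepFun_infinitePi (P := parentLaw θ) (X := fun _ x => x) (fun _ => measurable_id)
  have h2 : IndepFun (fun j : Parents => (Finset.range m).restrict j)
      (fun j : Parents => j m) (hoppeMeasure θ) :=
    (hind.indepFun_finset (Finset.range m) {m} (by simp) (fun i => measurable_pi_apply i)).comp
      (φ := id) (ψ := fun y : (i : ({m} : Finset ℕ)) → Fin ((i : ℕ) + 1) =>
        y ⟨m, Finset.mem_singleton_self m⟩) measurable_id
      (measurable_pi_apply (⟨m, Finset.mem_singleton_self m⟩ : ({m} : Finset ℕ)))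
  have h3 := h2.map_prod_eq_prod_map_map (Finset.measurable_restrict _).aemeasurable
    (measurable_pi_apply m).aemeasurable
  have h4 : (hoppeMeasure θ).map (fun j : Parents => j m) = parentLaw θ m :=
    Measure.infinitePi_map_eval _ m
  set ν := (hoppeMeasure θ).map (fun j : Parents => (Finset.range m).restrict j) with hν
  have : IsProbabilityMeasure ν :=
    Measure.isProbabilityMeasure_map (Finset.measurable_restrict _).aemeasurable
  set F : ((i : Finset.range m) → Fin ((i : ℕ) + 1)) × Fin (m + 1) → E :=
    fun y => f (extend (Finset.range m) y.1) y.2 with hF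
  have hFm : StronglyMeasurable F := StronglyMeasurable.of_discrete
  calc ∫ j, f j (j m) ∂hoppeMeasure θ
      = ∫ j, F ((Finset.range m).restrict j, j m) ∂hoppeMeasure θ := by
        simp only [hF, extend_restrict hf]
    _ = ∫ y, F y ∂(ν.prod (parentLaw θ m)) := by
        rw [← h4, ← h3, integral_map _ hFm.aestronglyMeasurable]
        exact ((Finset.measurable_restrict _).prodMk (measurable_pi_apply m)).aemeasurable
    _ = ∫ y, ∫ p, F (y, p) ∂parentLaw θ m ∂ν := integral_prod _ (.of_finite)
    _ = ∫ j, ∑ p, parentWeight θ m p • f j p ∂hoppeMeasure θ := by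
        rw [hν, integral_map (Finset.measurable_restrict _).aemeasurable
          (StronglyMeasurable.of_discrete).aestronglyMeasurable]
        simp only [hF, extend_restrict hf, integral_parentLaw hθ]

end Canonical

section Martingale

/-- `∑ D_k ^ 2` over the vertices `0, …, m`. -/
def sqLength (m : ℕ) (j : Parents) : ℝ := ∑ k ∈ Finset.range (m + 1), (depth j k : ℝ) ^ 2

/-- `U_n + T_n + 2 (θ + n - 1)` for `n = m + 1`. -/
def growth (θ : ℝ) (m : ℕ) (j : Parents) : ℝ :=
  pathSum j (m + 1) + totalLength j (m + 1) + 2 * (θ + m)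

/-- The martingale obtained by rescaling `growth`. -/
def mart (θ : ℝ) (m : ℕ) (j : Parents) : ℝ := growth θ m j / ((θ + m) * (θ + m + 1))

/-- The part of the increment of `growth` that depends on the parent `p` of the vertex `m + 1`. -/
def growthIncr (m : ℕ) (j : Parents) (p : ℕ) : ℝ :=
  2 * ∑ i ∈ Finset.range (m + 1), (commonDepth j i p : ℝ) + 2 * depth j p

lemma sqLength_succ (m : ℕ) (j : Parents) :
    sqLength (m + 1) j = sqLength m j + ((depth j (j m) : ℝ) + 1) ^ 2 := by
  rw [sqLength, Finset.sum_range_succ, ← sqLength, depth_succ]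
  push_cast
  rfl

lemma growth_succ (θ : ℝ) (m : ℕ) (j : Parents) :
    growth θ (m + 1) j = growth θ m j + growthIncr m j (j m) + 4 := by
  simp only [growth, growthIncr]
  rw [pathSum_add_two, totalLength_add_two]
  push_cast
  ring

lemma dependsOn_sqLength (m : ℕ) : DependsOn (sqLength m) (Set.Iio m) := fun _ _ h =>
  Finset.sum_congr rfl fun k hk => by
    rw [depth_congr h (by simpa [Nat.lt_succ_iff] using hk)]

lemma dependsOn_growth (θ : ℝ) (m : ℕ) : DependsOn (growth θ m) (Set.Iio m) := fun _ _ h => by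
  simp only [growth]
  rw [pathSum_congr h, totalLength_congr h]

lemma dependsOn_mart (θ : ℝ) (m : ℕ) : DependsOn (mart θ m) (Set.Iio m) := fun _ _ h => by
  rw [mart, mart, dependsOn_growth θ m h]

lemma dependsOn_growthIncr (m : ℕ) :
    DependsOn (fun j (p : Fin (m + 1)) => growthIncr m j p) (Set.Iio m) := fun j j' h => by
  funext p
  have hp : (p : ℕ) ≤ m := Nat.lt_succ_iff.mp p.isLt
  simp only [growthIncr]
  rw [depth_congr h hp]
  congr 2
  exact Finset.sum_congr rfl fun k hk => by
    rw [commonDepth_congr h (by simpa [Nat.lt_succ_iff] using hk) hp]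

/-- The average over the parent of a function that vanishes at the root. -/
lemma sum_parentWeight_mul (θ : ℝ) (m : ℕ) (f : ℕ → ℝ) (h0 : f 0 = 0) :
    ∑ p : Fin (m + 1), parentWeight θ m p * f p =
      (∑ k ∈ Finset.range (m + 1), f k) / (θ + m) := by
  rw [Finset.sum_range, Finset.sum_div]
  refine Finset.sum_congr rfl fun p _ => ?_
  unfold parentWeight
  split_ifs with hp
  · subst hp; simp [h0]
  · ring

lemma average_depth (θ : ℝ) (m : ℕ) (j : Parents) :
    ∑ p : Fin (m + 1), parentWeight θ m p * (depth j p : ℝ) =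
      totalLength j (m + 1) / (θ + m) := by
  rw [sum_parentWeight_mul θ m (fun p => (depth j p : ℝ)) (by simp [depth_zero]), totalLength]
  push_cast
  rfl

lemma average_depth_sq (θ : ℝ) (m : ℕ) (j : Parents) :
    ∑ p : Fin (m + 1), parentWeight θ m p * (depth j p : ℝ) ^ 2 = sqLength m j / (θ + m) := by
  rw [sum_parentWeight_mul θ m (fun p => (depth j p : ℝ) ^ 2) (by simp [depth_zero]), sqLength]

lemma average_growthIncr (θ : ℝ) (m : ℕ) (j : Parents) :
    ∑ p : Fin (m + 1), parentWeight θ m p * growthIncr m j p =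
      2 * (pathSum j (m + 1) + totalLength j (m + 1)) / (θ + m) := by
  rw [sum_parentWeight_mul θ m (growthIncr m j)
    (by simp [growthIncr, commonDepth_zero_right, depth_zero]), pathSum_eq_sum, totalLength]
  simp only [growthIncr, Finset.sum_add_distrib, ← Finset.mul_sum]
  rw [Finset.sum_comm]
  push_cast
  ring

lemma growthIncr_nonneg (m : ℕ) (j : Parents) (p : ℕ) : 0 ≤ growthIncr m j p := by
  unfold growthIncr; positivity

lemma growthIncr_le (m : ℕ) (j : Parents) (p : ℕ) :
    growthIncr m j p ≤ 2 * (m + 2) * depth j p := by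
  have : ∑ i ∈ Finset.range (m + 1), (commonDepth j i p : ℝ) ≤ (m + 1) * depth j p := by
    calc _ ≤ ∑ i ∈ Finset.range (m + 1), (depth j p : ℝ) :=
          Finset.sum_le_sum fun i _ => by exact_mod_cast commonDepth_le_right j i p
      _ = _ := by simp
  unfold growthIncr
  linarith

lemma average_growth {θ : ℝ} (hθ : 0 < θ) (m : ℕ) (j : Parents) :
    ∑ p : Fin (m + 1), parentWeight θ m p * (growth θ m j + growthIncr m j p + 4) =
      growth θ m j * (θ + m + 2) / (θ + m) := by
  have hw : θ + m ≠ 0 := by positivity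
  have : ∀ p : Fin (m + 1), parentWeight θ m p * (growth θ m j + growthIncr m j p + 4) =
      parentWeight θ m p * (growth θ m j + 4) + parentWeight θ m p * growthIncr m j p :=
    fun p => by ring
  simp only [this, Finset.sum_add_distrib, ← Finset.sum_mul, sum_parentWeight hθ,
    average_growthIncr]
  simp only [growth]
  field_simp
  ring

/-- The second moment of the increment. -/
lemma average_growth_sq_le {θ : ℝ} (hθ : 0 < θ) (m : ℕ) (j : Parents) :
    ∑ p : Fin (m + 1), parentWeight θ m p * (growth θ m j + growthIncr m j p + 4) ^ 2 ≤
      (growth θ m j * (θ + m + 2) / (θ + m)) ^ 2 +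
        4 * (m + 2) ^ 2 * (sqLength m j / (θ + m)) := by
  have h1 := average_growth hθ m j
  set g := growth θ m j
  set A := g * (θ + m + 2) / (θ + m)
  have e : ∀ p : Fin (m + 1), parentWeight θ m p * (g + growthIncr m j p + 4) ^ 2 =
      2 * (g + 4) * (parentWeight θ m p * (g + growthIncr m j p + 4)) -
      parentWeight θ m p * (g + 4) ^ 2 + parentWeight θ m p * growthIncr m j p ^ 2 :=
    fun p => by ring
  simp only [e, Finset.sum_add_distrib, Finset.sum_sub_distrib, ← Finset.mul_sum,
    ← Finset.sum_mul, sum_parentWeight hθ, h1]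
  have h2 : ∑ p : Fin (m + 1), parentWeight θ m p * growthIncr m j p ^ 2 ≤
      4 * (m + 2) ^ 2 * (sqLength m j / (θ + m)) := by
    rw [← average_depth_sq, Finset.mul_sum]
    refine Finset.sum_le_sum fun p _ => ?_
    have := pow_le_pow_left₀ (growthIncr_nonneg m j p) (growthIncr_le m j p) 2
    have := mul_le_mul_of_nonneg_left this (parentWeight_nonneg hθ m p)
    linarith
  nlinarith [sq_nonneg (A - (g + 4))]

lemma integral_growth_succ {θ : ℝ} (hθ : 0 < θ) (m : ℕ) {ψ : Parents → ℝ}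
    (hψ : DependsOn ψ (Set.Iio m)) :
    ∫ j, ψ j * growth θ (m + 1) j ∂hoppeMeasure θ =
      (θ + m + 2) / (θ + m) * ∫ j, ψ j * growth θ m j ∂hoppeMeasure θ := by
  simp only [growth_succ]
  rw [integral_parent hθ (f := fun j p => ψ j * (growth θ m j + growthIncr m j p + 4))]
  · rw [← integral_const_mul]
    congr 1
    funext j
    have : ∀ p : Fin (m + 1), parentWeight θ m p • (ψ j * (growth θ m j + growthIncr m j p + 4)) =
        ψ j * (parentWeight θ m p * (growth θ m j + growthIncr m j p + 4)) := fun p => by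
      rw [smul_eq_mul]; ring
    simp only [this, ← Finset.mul_sum, average_growth hθ]
    ring
  · intro j j' h
    funext p
    have := congrFun (dependsOn_growthIncr m h) p
    simp only at this
    simp only [hψ h, dependsOn_growth θ m h, this]

lemma integral_mart_succ {θ : ℝ} (hθ : 0 < θ) (m : ℕ) {ψ : Parents → ℝ}
    (hψ : DependsOn ψ (Set.Iio m)) :
    ∫ j, ψ j * mart θ (m + 1) j ∂hoppeMeasure θ = ∫ j, ψ j * mart θ m j ∂hoppeMeasure θ := by
  have hw : 0 < θ + m := by positivity
  simp only [mart, ← mul_div_assoc, integral_div]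
  rw [integral_growth_succ hθ m hψ]
  push_cast
  field_simp
  ring

lemma integral_mart_of_le {θ : ℝ} (hθ : 0 < θ) {m k : ℕ} (hmk : m ≤ k) {ψ : Parents → ℝ}
    (hψ : DependsOn ψ (Set.Iio m)) :
    ∫ j, ψ j * mart θ k j ∂hoppeMeasure θ = ∫ j, ψ j * mart θ m j ∂hoppeMeasure θ := by
  induction k, hmk using Nat.le_induction with
  | base => rfl
  | succ k hk ih =>
    rw [integral_mart_succ hθ k (hψ.mono (Set.Iio_subset_Iio hk)), ih]

lemma integral_mart {θ : ℝ} (hθ : 0 < θ) (m : ℕ) :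
    ∫ j, mart θ m j ∂hoppeMeasure θ = 2 / (1 + θ) := by
  have := isProbabilityMeasure_hoppeMeasure hθ
  have h := integral_mart_of_le hθ (Nat.zero_le m) (ψ := fun _ => 1) (dependsOn_const 1 |>.mono
    (Set.empty_subset _))
  simp only [one_mul] at h
  rw [h]
  simp only [mart, growth, zero_add, pathSum_one, totalLength_one, Nat.cast_zero]
  rw [integral_const]
  simp
  field_simp
  ring

lemma integral_mart_sub_sq {θ : ℝ} (hθ : 0 < θ) {m k : ℕ} (hmk : m ≤ k) :
    ∫ j, (mart θ k j - mart θ m j) ^ 2 ∂hoppeMeasure θ =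
      ∫ j, mart θ k j ^ 2 ∂hoppeMeasure θ - ∫ j, mart θ m j ^ 2 ∂hoppeMeasure θ := by
  have := isProbabilityMeasure_hoppeMeasure hθ
  have h := integral_mart_of_le hθ hmk (dependsOn_mart θ m)
  have dm : DependsOn (mart θ m) (Set.Iio k) :=
    (dependsOn_mart θ m).mono (Set.Iio_subset_Iio hmk)
  have dk := dependsOn_mart θ k
  have i1 : Integrable (fun j => mart θ k j ^ 2) (hoppeMeasure θ) :=
    integrable_of_dependsOn (m := k) (fun _ _ h => by simp only [dk h]) _
  have i2 : Integrable (fun j => mart θ m j ^ 2) (hoppeMeasure θ) :=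
    integrable_of_dependsOn (m := k) (fun _ _ h => by simp only [dm h]) _
  have i3 : Integrable (fun j => mart θ m j * mart θ k j) (hoppeMeasure θ) :=
    integrable_of_dependsOn (m := k) (fun _ _ h => by simp only [dm h, dk h]) _
  calc ∫ j, (mart θ k j - mart θ m j) ^ 2 ∂hoppeMeasure θ
      = ∫ j, (mart θ k j ^ 2 + mart θ m j ^ 2 - 2 * (mart θ m j * mart θ k j)) ∂hoppeMeasure θ := by
        congr 1; funext j; ring
    _ = _ := by
        rw [integral_sub (by exact i1.add i2) (i3.const_mul 2), integral_add i1 i2, integral_const_mul, h]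
        simp only [sq]
        ring

lemma integral_totalLength_succ {θ : ℝ} (hθ : 0 < θ) (m : ℕ) :
    ∫ j, (totalLength j (m + 2) : ℝ) ∂hoppeMeasure θ =
      (θ + m + 1) / (θ + m) * ∫ j, (totalLength j (m + 1) : ℝ) ∂hoppeMeasure θ + 1 := by
  have := isProbabilityMeasure_hoppeMeasure hθ
  have hw : 0 < θ + m := by positivity
  have iT : Integrable (fun j => (totalLength j (m + 1) : ℝ)) (hoppeMeasure θ) :=
    integrable_of_dependsOn (m := m) (fun _ _ h => by simp only [totalLength_congr h]) _
  simp only [totalLength_add_two]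
  push_cast
  rw [integral_parent hθ (f := fun j p => (totalLength j (m + 1) + ((depth j p : ℝ) + 1)))]
  · have : ∀ j : Parents, ∑ p : Fin (m + 1),
        parentWeight θ m p • (totalLength j (m + 1) + ((depth j p : ℝ) + 1)) =
        (θ + m + 1) / (θ + m) * totalLength j (m + 1) + 1 := by
      intro j
      simp only [smul_eq_mul, mul_add, Finset.sum_add_distrib, ← Finset.sum_mul,
        sum_parentWeight hθ, average_depth]
      field_simp
      ring
    simp only [this]
    rw [integral_add (iT.const_mul _) (integrable_const _), integral_const_mul]
    simp
  · intro j j' h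
    funext p
    simp only [totalLength_congr h, depth_congr h (Nat.lt_succ_iff.mp p.isLt)]

lemma integral_sqLength_succ {θ : ℝ} (hθ : 0 < θ) (m : ℕ) :
    ∫ j, sqLength (m + 1) j ∂hoppeMeasure θ =
      (θ + m + 1) / (θ + m) * ∫ j, sqLength m j ∂hoppeMeasure θ +
        2 / (θ + m) * ∫ j, (totalLength j (m + 1) : ℝ) ∂hoppeMeasure θ + 1 := by
  have := isProbabilityMeasure_hoppeMeasure hθ
  have hw : 0 < θ + m := by positivity
  have iT : Integrable (fun j => (totalLength j (m + 1) : ℝ)) (hoppeMeasure θ) :=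
    integrable_of_dependsOn (m := m) (fun _ _ h => by simp only [totalLength_congr h]) _
  have iS := integrable_of_dependsOn (dependsOn_sqLength m) (hoppeMeasure θ)
  simp only [sqLength_succ]
  rw [integral_parent hθ (f := fun j p => (sqLength m j + ((depth j p : ℝ) + 1) ^ 2))]
  · have : ∀ j : Parents, ∑ p : Fin (m + 1),
        parentWeight θ m p • (sqLength m j + ((depth j p : ℝ) + 1) ^ 2) =
        (θ + m + 1) / (θ + m) * sqLength m j + 2 / (θ + m) * totalLength j (m + 1) + 1 := by
      intro j
      have e : ∀ p : Fin (m + 1),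
          parentWeight θ m p • (sqLength m j + ((depth j p : ℝ) + 1) ^ 2) =
          parentWeight θ m p * (sqLength m j + 1) + parentWeight θ m p * (depth j p : ℝ) ^ 2 +
          2 * (parentWeight θ m p * (depth j p : ℝ)) := fun p => by rw [smul_eq_mul]; ring
      simp only [e, Finset.sum_add_distrib, ← Finset.sum_mul, ← Finset.mul_sum,
        sum_parentWeight hθ, average_depth, average_depth_sq]
      field_simp
      ring
    simp only [this]
    rw [integral_add (by exact (iS.const_mul _).add (iT.const_mul _)) (integrable_const _),
      integral_add (iS.const_mul _) (iT.const_mul _), integral_const_mul, integral_const_mul]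
    simp
  · intro j j' h
    funext p
    simp only [dependsOn_sqLength m h, depth_congr h (Nat.lt_succ_iff.mp p.isLt)]

lemma integral_mart_sq_succ_le {θ : ℝ} (hθ : 0 < θ) (m : ℕ) :
    ∫ j, mart θ (m + 1) j ^ 2 ∂hoppeMeasure θ ≤ ∫ j, mart θ m j ^ 2 ∂hoppeMeasure θ +
      4 * (∫ j, sqLength m j ∂hoppeMeasure θ) / ((θ + m) * (θ + m + 1) ^ 2) := by
  have := isProbabilityMeasure_hoppeMeasure hθ
  have hw : 0 < θ + m := by positivity
  have iG : Integrable (fun j => growth θ m j ^ 2) (hoppeMeasure θ) :=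
    integrable_of_dependsOn (m := m) (fun _ _ h => by simp only [dependsOn_growth θ m h]) _
  have iS := integrable_of_dependsOn (dependsOn_sqLength m) (hoppeMeasure θ)
  have hSnn : 0 ≤ ∫ j, sqLength m j ∂hoppeMeasure θ :=
    integral_nonneg fun j => Finset.sum_nonneg fun k _ => by positivity
  have key : ∫ j, growth θ (m + 1) j ^ 2 ∂hoppeMeasure θ ≤
      ((θ + m + 2) / (θ + m)) ^ 2 * ∫ j, growth θ m j ^ 2 ∂hoppeMeasure θ +
        4 * (m + 2) ^ 2 / (θ + m) * ∫ j, sqLength m j ∂hoppeMeasure θ := by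
    have hdep : DependsOn (fun j (p : Fin (m + 1)) =>
        (growth θ m j + growthIncr m j p + 4) ^ 2) (Set.Iio m) := by
      intro j j' h
      funext p
      have := congrFun (dependsOn_growthIncr m h) p
      simp only at this
      simp only [dependsOn_growth θ m h, this]
    simp only [growth_succ]
    rw [integral_parent hθ (f := fun j p => (growth θ m j + growthIncr m j p + 4) ^ 2) hdep,
      ← integral_const_mul, ← integral_const_mul, ← integral_add (iG.const_mul _) (iS.const_mul _)]
    refine integral_mono ?_ ((iG.const_mul _).add (iS.const_mul _)) fun j => ?_
    · refine integrable_of_dependsOn (m := m) (fun j j' h => ?_) _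
      have := hdep h
      simp only at this
      simp only [fun p => congrFun this p]
    · simp only [smul_eq_mul]
      refine (average_growth_sq_le hθ m j).trans (le_of_eq ?_)
      ring
  simp only [mart, div_pow, integral_div]
  push_cast
  have hb : ((m : ℝ) + 2) ^ 2 ≤ (θ + m + 2) ^ 2 := by gcongr; linarith
  have h3 : (0 : ℝ) < ((θ + (m + 1)) * (θ + (m + 1) + 1)) ^ 2 := by positivity
  rw [div_le_iff₀ h3]
  refine key.trans ?_
  set I := ∫ j, growth θ m j ^ 2 ∂hoppeMeasure θ
  set S := ∫ j, sqLength m j ∂hoppeMeasure θ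
  have e1 : (I / ((θ + m) * (θ + m + 1)) ^ 2 + 4 * S / ((θ + m) * (θ + m + 1) ^ 2)) *
      ((θ + (m + 1)) * (θ + (m + 1) + 1)) ^ 2 =
      ((θ + m + 2) / (θ + m)) ^ 2 * I + 4 * (θ + m + 2) ^ 2 / (θ + m) * S := by
    field_simp
    ring
  rw [e1]
  gcongr

/-- A Lyapunov function controlling the depths. -/
lemma lyapunov_succ_le {θ : ℝ} (hθ : 0 < θ) (m : ℕ) :
    (∫ j, sqLength (m + 1) j ∂hoppeMeasure θ +
      4 * ∫ j, (totalLength j (m + 2) : ℝ) ∂hoppeMeasure θ +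
      10 * (θ + m + 1)) / ((θ + m + 1) * (θ + m + 2)) ≤
    (1 - 1 / (2 * (θ + m + 2))) * ((∫ j, sqLength m j ∂hoppeMeasure θ +
      4 * ∫ j, (totalLength j (m + 1) : ℝ) ∂hoppeMeasure θ +
      10 * (θ + m)) / ((θ + m) * (θ + m + 1))) := by
  have hw : 0 < θ + m := by positivity
  have hSnn : 0 ≤ ∫ j, sqLength m j ∂hoppeMeasure θ :=
    integral_nonneg fun j => Finset.sum_nonneg fun k _ => by positivity
  rw [integral_sqLength_succ hθ, integral_totalLength_succ hθ]
  set S := ∫ j, sqLength m j ∂hoppeMeasure θ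
  set T := ∫ j, (totalLength j (m + 1) : ℝ) ∂hoppeMeasure θ
  set w := θ + m
  have e : (1 - 1 / (2 * (w + 2))) * ((S + 4 * T + 10 * w) / (w * (w + 1))) -
      ((w + 1) / w * S + 2 / w * T + 1 + 4 * ((w + 1) / w * T + 1) + 10 * (w + 1)) /
        ((w + 1) * (w + 2)) = S / (2 * w * (w + 1) * (w + 2)) := by
    field_simp
    ring
  have : 0 ≤ S / (2 * w * (w + 1) * (w + 2)) := by positivity
  linarith

lemma bddAbove_integral_mart_sq {θ : ℝ} (hθ : 0 < θ) :
    BddAbove (Set.range fun m => ∫ j, mart θ m j ^ 2 ∂hoppeMeasure θ) := by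
  set g : ℕ → ℝ := fun m => (∫ j, sqLength m j ∂hoppeMeasure θ +
      4 * ∫ j, (totalLength j (m + 1) : ℝ) ∂hoppeMeasure θ +
      10 * (θ + m)) / ((θ + m) * (θ + m + 1)) with hg
  have hSnn : ∀ m, 0 ≤ ∫ j, sqLength m j ∂hoppeMeasure θ := fun m =>
    integral_nonneg fun j => Finset.sum_nonneg fun k _ => by positivity
  have hTnn : ∀ m : ℕ, 0 ≤ ∫ j, (totalLength j (m + 1) : ℝ) ∂hoppeMeasure θ := fun m =>
    integral_nonneg fun j => by positivity
  have hgnn : ∀ m, 0 ≤ g m := fun m => by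
    have := hSnn m
    have := hTnn m
    simp only [hg]
    positivity
  have hstep : ∀ m, ∫ j, mart θ (m + 1) j ^ 2 ∂hoppeMeasure θ + 16 * g (m + 1) ≤
      ∫ j, mart θ m j ^ 2 ∂hoppeMeasure θ + 16 * g m := by
    intro m
    have hw : 0 < θ + m := by positivity
    have h1 := integral_mart_sq_succ_le hθ m
    have h2 : g (m + 1) ≤ (1 - 1 / (2 * (θ + m + 2))) * g m := by
      have := lyapunov_succ_le hθ m
      simp only [hg]
      push_cast
      convert this using 3 <;> ring
    have h3 : 4 * (∫ j, sqLength m j ∂hoppeMeasure θ) / ((θ + m) * (θ + m + 1) ^ 2) ≤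
        4 * g m / (θ + m + 1) := by
      rw [div_le_div_iff₀ (by positivity) (by positivity)]
      simp only [hg]
      have := hTnn m
      set S := ∫ j, sqLength m j ∂hoppeMeasure θ
      set T := ∫ j, (totalLength j (m + 1) : ℝ) ∂hoppeMeasure θ
      set w := θ + m
      have e : 4 * ((S + 4 * T + 10 * w) / (w * (w + 1))) * (w * (w + 1) ^ 2) =
        4 * (S + 4 * T + 10 * w) * (w + 1) := by field_simp
      rw [e]
      gcongr
      linarith
    have h4 : 4 * g m / (θ + m + 1) ≤ 16 * (1 / (2 * (θ + m + 2)) * g m) := by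
      have e : 16 * (1 / (2 * (θ + m + 2)) * g m) = 8 * g m / (θ + m + 2) := by
        field_simp
        ring
      rw [e, div_le_div_iff₀ (by positivity) (by positivity)]
      have := hgnn m
      have : 0 ≤ g m * (θ + m) := by positivity
      nlinarith
    linarith
  have hle : ∀ m, ∫ j, mart θ m j ^ 2 ∂hoppeMeasure θ + 16 * g m ≤
      ∫ j, mart θ 0 j ^ 2 ∂hoppeMeasure θ + 16 * g 0 := by
    intro m
    induction m with
    | zero => exact le_rfl
    | succ m ih => exact (hstep m).trans ih
  refine ⟨∫ j, mart θ 0 j ^ 2 ∂hoppeMeasure θ + 16 * g 0, ?_⟩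
  rintro _ ⟨m, rfl⟩
  have := hle m
  have := hgnn m
  simp only
  linarith

end Martingale

section Limit

open Topology

lemma norm_toLp_sub_sq {Ω : Type*} [MeasurableSpace Ω] {μ : Measure Ω} {f g : Ω → ℝ}
    (hf : MemLp f 2 μ) (hg : MemLp g 2 μ) :
    ‖hf.toLp f - hg.toLp g‖ ^ 2 = ∫ x, (f x - g x) ^ 2 ∂μ := by
  rw [← MemLp.toLp_sub, ← real_inner_self_eq_norm_sq, L2.inner_def]
  refine integral_congr_ae ?_
  filter_upwards [(hf.sub hg).coeFn_toLp] with x hx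
  rw [hx]
  simp [sq]

/-- A sequence with summing square increments converges in `L²`. -/
lemma exists_tendsto_eLpNorm_of_integral_sub_sq {Ω : Type*} [MeasurableSpace Ω] {μ : Measure Ω}
    {f : ℕ → Ω → ℝ} (hf : ∀ n, MemLp (f n) 2 μ) {h : ℕ → ℝ} (hb : BddAbove (Set.range h))
    (hfh : ∀ m k, m ≤ k → ∫ x, (f k x - f m x) ^ 2 ∂μ = h k - h m) :
    ∃ Z : Ω → ℝ, Measurable Z ∧ MemLp Z 2 μ ∧
      Tendsto (fun n => eLpNorm (f n - Z) 2 μ) atTop (𝓝 0) := by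
  have hmono : Monotone h := fun m k hmk => by
    have := hfh m k hmk
    have h0 : 0 ≤ ∫ x, (f k x - f m x) ^ 2 ∂μ := integral_nonneg fun x => sq_nonneg _
    linarith
  have hlim := tendsto_atTop_ciSup hmono hb
  have hcau : CauchySeq fun n => (hf n).toLp (f n) := by
    refine Metric.cauchySeq_iff'.mpr fun ε hε => ?_
    obtain ⟨N, hN⟩ := Metric.cauchySeq_iff'.mp hlim.cauchySeq (ε ^ 2) (by positivity)
    refine ⟨N, fun n hn => ?_⟩
    have h1 := hN n hn
    rw [Real.dist_eq] at h1
    rw [dist_eq_norm]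
    refine lt_of_pow_lt_pow_left₀ 2 hε.le ?_
    rw [norm_toLp_sub_sq, hfh N n hn]
    exact (le_abs_self _).trans_lt h1
  obtain ⟨F, hF⟩ := cauchySeq_tendsto_of_complete hcau
  have hFm : MemLp F 2 μ := Lp.memLp F
  obtain ⟨Z, hZm, hZ⟩ := hFm.aestronglyMeasurable.aemeasurable
  refine ⟨Z, hZm, hFm.ae_eq hZ, ?_⟩
  have h2 := (Lp.tendsto_Lp_iff_tendsto_eLpNorm' (fun n => (hf n).toLp (f n)) F).mp hF
  refine h2.congr fun n => eLpNorm_congr_ae ?_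
  filter_upwards [(hf n).coeFn_toLp, hZ] with x h3 h4
  simp [h3, h4]

lemma integral_totalLength {θ : ℝ} (hθ : 0 < θ) (m : ℕ) :
    ∫ j, (totalLength j (m + 1) : ℝ) ∂hoppeMeasure θ =
      (θ + m) * ∑ i ∈ Finset.range m, 1 / (θ + i + 1) := by
  induction m with
  | zero => simp [totalLength_one]
  | succ m ih =>
    have hw : 0 < θ + m := by positivity
    rw [integral_totalLength_succ hθ, ih, Finset.sum_range_succ]
    push_cast
    field_simp
    ring

lemma tendsto_ratio (a : ℝ) : Tendsto (fun m : ℕ => (a + m) / ((m : ℝ) + 1)) atTop (𝓝 1) := by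
  have h : Tendsto (fun m : ℕ => 1 + (a - 1) * (1 / ((m : ℝ) + 1))) atTop (𝓝 (1 + (a - 1) * 0)) :=
    tendsto_const_nhds.add (tendsto_one_div_add_atTop_nhds_zero_nat.const_mul _)
  rw [mul_zero, add_zero] at h
  refine h.congr fun m => ?_
  have : (m : ℝ) + 1 ≠ 0 := by positivity
  field_simp
  ring

lemma tendsto_integral_totalLength_div {θ : ℝ} (hθ : 0 < θ) :
    Tendsto (fun m : ℕ => (∫ j, (totalLength j (m + 1) : ℝ) ∂hoppeMeasure θ) / ((m : ℝ) + 1) ^ 2)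
      atTop (𝓝 0) := by
  have h1 : Tendsto (fun i : ℕ => 1 / (θ + i + 1)) atTop (𝓝 0) := by
    refine squeeze_zero (fun i => by positivity) (fun i => ?_)
      tendsto_one_div_add_atTop_nhds_zero_nat
    gcongr
    linarith
  have h2 := h1.cesaro
  have h3 : Tendsto (fun m : ℕ => (m : ℝ) / (m + 1)) atTop (𝓝 1) :=
    tendsto_natCast_div_add_atTop 1
  have h4 := ((tendsto_ratio θ).mul h2).mul h3
  simp only [mul_zero, zero_mul] at h4
  refine h4.congr fun m => ?_
  rw [integral_totalLength hθ]
  rcases Nat.eq_zero_or_pos m with rfl | hm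
  · simp
  · have : (0 : ℝ) < m := by exact_mod_cast hm
    field_simp

/-- The rescaled `U_n`. -/
def scaledSum (n : ℕ) (j : Parents) : ℝ := (pathSum j n : ℝ) / (n : ℝ) ^ 2

lemma measurable_scaledSum (n : ℕ) : Measurable (scaledSum n) := by
  cases n with
  | zero =>
    have : scaledSum 0 = fun _ => 0 := funext fun j => by simp [scaledSum]
    rw [this]
    exact measurable_const
  | succ m =>
    exact measurable_of_dependsOn (m := m) fun _ _ h => by
      simp only [scaledSum, pathSum_congr h]

lemma integrable_scaledSum {θ : ℝ} (hθ : 0 < θ) (n : ℕ) :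
    Integrable (scaledSum n) (hoppeMeasure θ) := by
  have := isProbabilityMeasure_hoppeMeasure hθ
  cases n with
  | zero =>
    have : scaledSum 0 = fun _ => 0 := funext fun j => by simp [scaledSum]
    rw [this]
    exact integrable_const _
  | succ m =>
    exact integrable_of_dependsOn (m := m) (fun _ _ h => by
      simp only [scaledSum, pathSum_congr h]) _

lemma scaledSum_nonneg (n : ℕ) (j : Parents) : 0 ≤ scaledSum n j := by
  unfold scaledSum; positivity

/-- `U_n / n ^ 2` converges in `L¹`, to a square integrable limit. -/
theorem exists_limit {θ : ℝ} (hθ : 0 < θ) : ∃ Z : Parents → ℝ, Measurable Z ∧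
    MemLp Z 2 (hoppeMeasure θ) ∧ ∫ j, Z j ∂hoppeMeasure θ = 2 / (1 + θ) ∧
    (∀ᵐ j ∂hoppeMeasure θ, 0 ≤ Z j) ∧
    Tendsto (fun n => ∫ j, |scaledSum n j - Z j| ∂hoppeMeasure θ) atTop (𝓝 0) := by
  have := isProbabilityMeasure_hoppeMeasure hθ
  have hL : ∀ m, MemLp (mart θ m) 2 (hoppeMeasure θ) :=
    fun m => memLp_of_dependsOn (dependsOn_mart θ m) _ 2
  obtain ⟨Z, hZm, hZ, hlim⟩ := exists_tendsto_eLpNorm_of_integral_sub_sq hL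
    (bddAbove_integral_mart_sq hθ) (fun m k hmk => integral_mart_sub_sq hθ hmk)
  have iZ : Integrable Z (hoppeMeasure θ) := hZ.integrable one_le_two
  have iM : ∀ m, Integrable (mart θ m) (hoppeMeasure θ) := fun m => (hL m).integrable one_le_two
  have h1 : Tendsto (fun m => ∫ j, |mart θ m j - Z j| ∂hoppeMeasure θ) atTop (𝓝 0) := by
    have h2 : Tendsto (fun m => eLpNorm (mart θ m - Z) 1 (hoppeMeasure θ)) atTop (𝓝 0) :=
      tendsto_of_tendsto_of_tendsto_of_le_of_le tendsto_const_nhds hlim (fun _ => zero_le)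
        fun m => eLpNorm_le_eLpNorm_of_exponent_le one_le_two ((hL m).sub hZ).aestronglyMeasurable
    have h3 := (ENNReal.tendsto_toReal ENNReal.zero_ne_top).comp h2
    refine h3.congr fun m => ?_
    simp only [Function.comp_apply]
    rw [eLpNorm_one_eq_lintegral_enorm, ← integral_norm_eq_lintegral_enorm
      ((hL m).sub hZ).aestronglyMeasurable]
    rfl
  have hmean : ∫ j, Z j ∂hoppeMeasure θ = 2 / (1 + θ) := by
    have h2 : Tendsto (fun m => ∫⁻ j, ‖mart θ m j - Z j‖ₑ ∂hoppeMeasure θ) atTop (𝓝 0) := by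
      rw [← ENNReal.tendsto_toReal_iff
        (fun m => by exact ((iM m).sub iZ).hasFiniteIntegral.ne) ENNReal.zero_ne_top]
      refine h1.congr fun m => ?_
      exact integral_norm_eq_lintegral_enorm ((hL m).sub hZ).aestronglyMeasurable
    have h3 := tendsto_integral_of_L1 Z iZ.aestronglyMeasurable (Eventually.of_forall iM) h2
    simp only [integral_mart hθ] at h3
    exact tendsto_nhds_unique h3 tendsto_const_nhds
  have hL1 : Tendsto (fun m : ℕ => ∫ j, |scaledSum (m + 1) j - Z j| ∂hoppeMeasure θ)
      atTop (𝓝 0) := by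
    set r : ℕ → ℝ := fun m => (θ + m) / ((m : ℝ) + 1) * ((θ + 1 + m) / ((m : ℝ) + 1)) with hr
    have hrlim : Tendsto r atTop (𝓝 1) := by
      simpa using (tendsto_ratio θ).mul (tendsto_ratio (θ + 1))
    set e : ℕ → ℝ := fun m =>
      (∫ j, (totalLength j (m + 1) : ℝ) ∂hoppeMeasure θ) / ((m : ℝ) + 1) ^ 2 +
      2 * ((θ + m) / ((m : ℝ) + 1) * (1 / ((m : ℝ) + 1))) with he
    have helim : Tendsto e atTop (𝓝 0) := by
      have := (tendsto_integral_totalLength_div hθ).add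
        (((tendsto_ratio θ).mul tendsto_one_div_add_atTop_nhds_zero_nat).const_mul 2)
      rwa [mul_zero, mul_zero, add_zero] at this
    have hbound : Tendsto (fun m => r m * ∫ j, |mart θ m j - Z j| ∂hoppeMeasure θ +
        |r m - 1| * ∫ j, |Z j| ∂hoppeMeasure θ + e m) atTop (𝓝 0) := by
      have h5 : Tendsto (fun m => |r m - 1|) atTop (𝓝 0) := by
        simpa using (hrlim.sub_const 1).abs
      simpa using ((hrlim.mul h1).add (h5.mul_const (∫ j, |Z j| ∂hoppeMeasure θ))).add helim
    refine squeeze_zero (fun m => integral_nonneg fun j => abs_nonneg _) (fun m => ?_) hbound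
    have hw : 0 < θ + m := by positivity
    have hm : (0 : ℝ) < (m : ℝ) + 1 := by positivity
    have hrnn : 0 ≤ r m := by simp only [hr]; positivity
    have iT : Integrable (fun j => (totalLength j (m + 1) : ℝ)) (hoppeMeasure θ) :=
      integrable_of_dependsOn (m := m) (fun _ _ h => by simp only [totalLength_congr h]) _
    have i1 : Integrable (fun j => r m * |mart θ m j - Z j|) (hoppeMeasure θ) :=
      ((iM m).sub iZ).abs.const_mul _
    have i2 : Integrable (fun j => |r m - 1| * |Z j|) (hoppeMeasure θ) := iZ.abs.const_mul _
    have i3 : Integrable (fun j => (totalLength j (m + 1) : ℝ) / ((m : ℝ) + 1) ^ 2 +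
        2 * ((θ + m) / ((m : ℝ) + 1) * (1 / ((m : ℝ) + 1)))) (hoppeMeasure θ) :=
      (iT.div_const _).add (integrable_const _)
    have hint : ∫ j, (r m * |mart θ m j - Z j| + |r m - 1| * |Z j| +
        ((totalLength j (m + 1) : ℝ) / ((m : ℝ) + 1) ^ 2 +
        2 * ((θ + m) / ((m : ℝ) + 1) * (1 / ((m : ℝ) + 1))))) ∂hoppeMeasure θ =
        r m * ∫ j, |mart θ m j - Z j| ∂hoppeMeasure θ +
        |r m - 1| * ∫ j, |Z j| ∂hoppeMeasure θ + e m := by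
      rw [integral_add (by exact i1.add i2) i3, integral_add i1 i2, integral_const_mul,
        integral_const_mul, integral_add (iT.div_const _) (integrable_const _), integral_div]
      simp [he]
    rw [← hint]
    refine integral_mono ((integrable_scaledSum hθ _).sub iZ).abs ((i1.add i2).add i3) fun j => ?_
    have hdec : scaledSum (m + 1) j - Z j = r m * (mart θ m j - Z j) + (r m - 1) * Z j -
        ((totalLength j (m + 1) : ℝ) / ((m : ℝ) + 1) ^ 2 +
        2 * ((θ + m) / ((m : ℝ) + 1) * (1 / ((m : ℝ) + 1)))) := by
      simp only [scaledSum, mart, growth, hr]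
      push_cast
      have : θ + 1 + m = θ + m + 1 := by ring
      rw [this]
      field_simp
      ring
    have hpos : 0 ≤ (totalLength j (m + 1) : ℝ) / ((m : ℝ) + 1) ^ 2 +
        2 * ((θ + m) / ((m : ℝ) + 1) * (1 / ((m : ℝ) + 1))) := by positivity
    simp only
    rw [hdec]
    refine (abs_sub _ _).trans (add_le_add ((abs_add_le _ _).trans (add_le_add ?_ ?_)) ?_)
    · rw [abs_mul, abs_of_nonneg hrnn]
    · rw [abs_mul]
    · rw [abs_of_nonneg hpos]
  have hL1' := (tendsto_add_atTop_iff_nat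
    (f := fun n => ∫ j, |scaledSum n j - Z j| ∂hoppeMeasure θ) 1).mp hL1
  refine ⟨Z, hZm, hZ, hmean, ?_, hL1'⟩
  have iN : Integrable (fun j => max (-Z j) 0) (hoppeMeasure θ) := iZ.neg.pos_part
  have h6 : ∫ j, max (-Z j) 0 ∂hoppeMeasure θ ≤ 0 := by
    refine ge_of_tendsto' hL1' fun n => ?_
    refine integral_mono iN ((integrable_scaledSum hθ _).sub iZ).abs fun j => ?_
    have := scaledSum_nonneg n j
    exact max_le ((by linarith : -Z j ≤ scaledSum n j - Z j).trans (le_abs_self _)) (abs_nonneg _)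
  have h7 := (integral_eq_zero_iff_of_nonneg (fun j => le_max_right _ _) iN).mp
    (le_antisymm h6 (integral_nonneg fun j => le_max_right _ _))
  filter_upwards [h7] with j hj
  have := le_max_left (-Z j) 0
  simp only [Pi.zero_apply] at hj
  linarith

end Limit

/-! ### Decomposition at the first child of the root

A rooted tree with ordered children is either a single vertex, or it splits into the subtree of the
first child of the root and the remaining tree with the old root. The vertices of the tree are the
leaves of the resulting binary tree. -/

/-- Binary trees. -/
inductive Shape : Type
  | leaf : Shape
  | node : Shape → Shape → Shape

/-- Binary trees with labelled leaves. -/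
inductive LTree : Type
  | leaf : ℕ → LTree
  | node : LTree → LTree → LTree

namespace Shape

/-- The number of leaves. -/
def size : Shape → ℕ
  | leaf => 1
  | node s r => size s + size r

/-- The sum of the squared sizes of all left subtrees. -/
def weight : Shape → ℕ
  | leaf => 0
  | node s r => weight s + weight r + size s ^ 2

/-- The sum of `F` over all trees obtained by splitting a leaf, where splitting the rightmost leaf
counts `θ` times. -/
def gen (θ : ℝ) : Shape → (Shape → ℂ) → ℂ
  | leaf, F => θ * F (node leaf leaf)
  | node s r, F => gen 1 s (fun s' => F (node s' r)) + gen θ r (fun r' => F (node s r'))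

/-- The expectation of `F` at the tree with `m + 1` leaves obtained by successively splitting random
leaves, where the rightmost leaf has weight `θ` and the others have weight `1`. -/
def mean (θ : ℝ) : ℕ → (Shape → ℂ) → ℂ
  | 0, F => F leaf
  | m + 1, F => mean θ m (fun t => gen θ t F) / (θ + m)

lemma gen_add (θ : ℝ) (t : Shape) (F G : Shape → ℂ) :
    gen θ t (fun s => F s + G s) = gen θ t F + gen θ t G := by
  induction t generalizing θ F G with
  | leaf => simp only [gen]; ring
  | node s r hs hr => simp only [gen, hs, hr]; ring

lemma gen_mul_left (θ : ℝ) (t : Shape) (c : ℂ) (F : Shape → ℂ) :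
    gen θ t (fun s => c * F s) = c * gen θ t F := by
  induction t generalizing θ F with
  | leaf => simp only [gen]; ring
  | node s r hs hr => simp only [gen, hs, hr]; ring

lemma mean_add (θ : ℝ) (m : ℕ) (F G : Shape → ℂ) :
    mean θ m (fun s => F s + G s) = mean θ m F + mean θ m G := by
  induction m generalizing F G with
  | zero => rfl
  | succ m ih => simp only [mean, gen_add, ih]; ring

lemma mean_mul_left (θ : ℝ) (m : ℕ) (c : ℂ) (F : Shape → ℂ) :
    mean θ m (fun s => c * F s) = c * mean θ m F := by
  induction m generalizing F with
  | zero => rfl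
  | succ m ih => simp only [mean, gen_mul_left, ih]; ring

lemma mean_mul_right (θ : ℝ) (m : ℕ) (c : ℂ) (F : Shape → ℂ) :
    mean θ m (fun s => F s * c) = mean θ m F * c := by
  simp only [mul_comm _ c, mean_mul_left]

lemma mean_gen (θ θ' : ℝ) (m : ℕ) (s : Shape) (G : Shape → Shape → ℂ) :
    mean θ m (fun r => gen θ' s (fun s' => G s' r)) = gen θ' s (fun s' => mean θ m (G s')) := by
  induction s generalizing θ' G with
  | leaf => simp only [gen, mean_mul_left]
  | node s r hs hr => simp only [gen, mean_add, hs, hr]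

lemma gen_congr (θ : ℝ) (t : Shape) {F G : Shape → ℂ}
    (h : ∀ s, size s = size t + 1 → F s = G s) : gen θ t F = gen θ t G := by
  induction t generalizing θ F G with
  | leaf => simp only [gen]; rw [h _ rfl]
  | node s r hs hr =>
    simp only [gen]
    rw [hs 1 fun s' hs' => h _ (by simp only [size]; omega),
      hr θ fun r' hr' => h _ (by simp only [size]; omega)]

lemma mean_congr (θ : ℝ) (m : ℕ) {F G : Shape → ℂ} (h : ∀ s, size s = m + 1 → F s = G s) :
    mean θ m F = mean θ m G := by
  induction m generalizing F G with
  | zero => exact h leaf rfl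
  | succ m ih =>
    simp only [mean]
    rw [ih fun t ht => gen_congr θ t fun s hs => h s (by omega)]

/-- The decomposition of the random tree with `n + 2` leaves at its root. -/
lemma mean_succ_eq_sum {θ : ℝ} (hθ : 0 < θ) {c : ℕ → ℕ → ℝ} (h0 : c 0 0 = 1)
    (h1 : ∀ a b : ℕ, c (a + 1) b * (θ + a + b + 1) = c a b * (a + 1))
    (h2 : ∀ a b : ℕ, c a (b + 1) * (θ + a + b + 1) = c a b * (θ + b)) (n : ℕ) (F : Shape → ℂ) :
    mean θ (n + 1) F = ∑ ab ∈ Finset.HasAntidiagonal.antidiagonal n, (n.choose ab.1 : ℂ) *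
      (c ab.1 ab.2 * mean 1 ab.1 (fun s => mean θ ab.2 (fun r => F (node s r)))) := by
  induction n generalizing F with
  | zero =>
    have : (θ : ℂ) ≠ 0 := by exact_mod_cast hθ.ne'
    simp [mean, gen, h0]
    field_simp
  | succ n ih =>
    have hpos : ∀ x : ℕ, (θ : ℂ) + x ≠ 0 := fun x => by
      have : (0 : ℝ) < θ + x := by positivity
      exact_mod_cast this.ne'
    have hpos1 : ∀ x : ℕ, (1 : ℂ) + x ≠ 0 := fun x => by
      have : (0 : ℝ) < 1 + x := by positivity
      exact_mod_cast this.ne'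
    rw [Finset.sum_antidiagonal_choose_succ_mul
      (fun a b => (c a b * mean 1 a (fun s => mean θ b (fun r => F (node s r))) : ℂ)), mean, ih,
      Finset.sum_div, ← Finset.sum_add_distrib]
    refine Finset.sum_congr rfl fun ab hab => ?_
    obtain ⟨a, b⟩ := ab
    rw [Finset.HasAntidiagonal.mem_antidiagonal] at hab
    simp only at hab ⊢
    have hchoose : n.choose b = n.choose a := by
      rw [← hab]; exact (Nat.choose_symm_add).symm
    have e1 : (c (a + 1) b : ℂ) = c a b * (a + 1) / (θ + (n + 1 : ℕ)) := by
      rw [eq_div_iff (hpos _), ← hab]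
      have := h1 a b
      push_cast
      rw [show (θ : ℂ) + (a + b + 1) = θ + a + b + 1 by ring]
      exact_mod_cast this
    have e2 : (c a (b + 1) : ℂ) = c a b * (θ + b) / (θ + (n + 1 : ℕ)) := by
      rw [eq_div_iff (hpos _), ← hab]
      have := h2 a b
      push_cast
      rw [show (θ : ℂ) + (a + b + 1) = θ + a + b + 1 by ring]
      exact_mod_cast this
    have e3 : mean 1 a (fun s => mean θ b (fun r => gen θ (node s r) F)) =
        (1 + a) * mean 1 (a + 1) (fun s => mean θ b (fun r => F (node s r))) +
        (θ + b) * mean 1 a (fun s => mean θ (b + 1) (fun r => F (node s r))) := by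
      simp only [gen, mean_add]
      congr 1
      · rw [mean, Complex.ofReal_one, mul_div_cancel₀ _ (hpos1 a)]
        simp only [mean_gen θ 1 b _ (fun s' r => F (node s' r))]
      · rw [← mean_mul_left]
        congr 1
        funext s
        rw [mean, mul_div_cancel₀ _ (hpos b)]
    rw [hchoose, e1, e2, e3]
    ring

end Shape

namespace LTree

/-- The set of the labels. -/
def leaves : LTree → Finset ℕ
  | leaf q => {q}
  | node s r => leaves s ∪ leaves r

/-- The underlying binary tree. -/
def shape : LTree → Shape
  | leaf _ => Shape.leaf
  | node s r => Shape.node (shape s) (shape r)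

/-- The label of the rightmost leaf. -/
def root : LTree → ℕ
  | leaf q => q
  | node _ r => root r

/-- The labels are pairwise distinct. -/
def Proper : LTree → Prop
  | leaf _ => True
  | node s r => Disjoint (leaves s) (leaves r) ∧ Proper s ∧ Proper r

/-- Splitting the leaf `p` into a new left leaf `n` and the old leaf `p` to the right. -/
def ins (p n : ℕ) : LTree → LTree
  | leaf q => if q = p then node (leaf n) (leaf q) else leaf q
  | node s r => node (ins p n s) (ins p n r)

/-- The number of left subtrees that contain both `i` and `k`. -/
def common (i k : ℕ) : LTree → ℕ
  | leaf _ => 0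
  | node s r => common i k s + common i k r + if i ∈ leaves s ∧ k ∈ leaves s then 1 else 0

lemma root_mem_leaves (t : LTree) : root t ∈ leaves t := by
  induction t with
  | leaf q => simp [root, leaves]
  | node s r _ hr => simp [root, leaves, hr]

lemma ins_of_notMem {p n : ℕ} {t : LTree} (h : p ∉ leaves t) : ins p n t = t := by
  induction t with
  | leaf q => simp only [leaves, Finset.mem_singleton] at h; simp [ins, Ne.symm h]
  | node s r hs hr =>
    simp only [leaves, Finset.mem_union, not_or] at h
    rw [ins, hs h.1, hr h.2]

lemma mem_leaves_ins {p n i : ℕ} {t : LTree} :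
    i ∈ leaves (ins p n t) ↔ i ∈ leaves t ∨ (i = n ∧ p ∈ leaves t) := by
  induction t with
  | leaf q =>
    simp only [ins, leaves, Finset.mem_singleton]
    split_ifs with h
    · subst h; simp [leaves, or_comm]
    · simp [leaves, Ne.symm h]
  | node s r hs hr =>
    simp only [ins, leaves, Finset.mem_union, hs, hr]
    tauto

lemma root_ins (p n : ℕ) (t : LTree) : root (ins p n t) = root t := by
  induction t with
  | leaf q => simp only [ins]; split_ifs <;> rfl
  | node s r _ hr => simp [ins, root, hr]

lemma proper_ins {p n : ℕ} {t : LTree} (ht : Proper t) (hn : n ∉ leaves t) :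
    Proper (ins p n t) := by
  induction t with
  | leaf q =>
    simp only [leaves, Finset.mem_singleton] at hn
    simp only [ins]; split_ifs <;> simp [Proper, leaves, hn]
  | node s r hs hr =>
    simp only [leaves, Finset.mem_union, not_or] at hn
    obtain ⟨hd, h1, h2⟩ := ht
    refine ⟨?_, hs h1 hn.1, hr h2 hn.2⟩
    rw [Finset.disjoint_left] at hd ⊢
    intro i hi hi'
    rw [mem_leaves_ins] at hi hi'
    rcases hi with hi | ⟨rfl, hi⟩ <;> rcases hi' with hi' | ⟨hi1, hi'⟩
    · exact hd hi hi'
    · exact hn.1 (hi1 ▸ hi)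
    · exact hn.2 hi'
    · exact hd hi hi'

lemma common_ins_of_ne {p n i k : ℕ} (t : LTree) (hi : i ≠ n) (hk : k ≠ n) :
    common i k (ins p n t) = common i k t := by
  induction t with
  | leaf q => simp only [ins]; split_ifs <;> simp [common, leaves, hi]
  | node s r hs hr => simp [ins, common, hs, hr, mem_leaves_ins, hi, hk]

lemma common_ins_new {p n i : ℕ} {t : LTree} (hi : i ≠ n) (hn : n ∉ leaves t) :
    common i n (ins p n t) = common i p t := by
  induction t with
  | leaf q => simp only [ins]; split_ifs <;> simp [common, leaves, hi]
  | node s r hs hr =>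
    simp only [leaves, Finset.mem_union, not_or] at hn
    simp [ins, common, hs hn.1, hr hn.2, mem_leaves_ins, hi, hn.1]

lemma common_eq_zero {i k : ℕ} {t : LTree} (hi : i ∉ leaves t) : common i k t = 0 := by
  induction t with
  | leaf q => rfl
  | node s r hs hr =>
    simp only [leaves, Finset.mem_union, not_or] at hi
    simp [common, hs hi.1, hr hi.2, hi.1]

lemma common_comm (i k : ℕ) (t : LTree) : common i k t = common k i t := by
  induction t with
  | leaf q => rfl
  | node s r hs hr => simp only [common, hs, hr, and_comm]

lemma common_ins_self {p n : ℕ} {t : LTree} (ht : Proper t) (hp : p ∈ leaves t)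
    (hn : n ∉ leaves t) : common n n (ins p n t) = common p p t + 1 := by
  induction t with
  | leaf q =>
    simp only [leaves, Finset.mem_singleton] at hp
    simp [ins, hp, common, leaves]
  | node s r hs hr =>
    simp only [leaves, Finset.mem_union, not_or] at hn hp
    obtain ⟨hd, h1, h2⟩ := ht
    rw [Finset.disjoint_left] at hd
    rcases hp with hp | hp
    · have hpr := hd hp
      simp only [ins, common, hs h1 hp hn.1, ins_of_notMem hpr, common_eq_zero hn.2,
        common_eq_zero hpr, mem_leaves_ins, hp]
      simp
    · have hps : p ∉ leaves s := fun h => hd h hp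
      simp only [ins, common, hr h2 hp hn.2, ins_of_notMem hps, common_eq_zero hn.1,
        common_eq_zero hps, hps, hn.1]
      simp

lemma card_leaves {t : LTree} (ht : Proper t) : (leaves t).card = t.shape.size := by
  induction t with
  | leaf q => simp [leaves, shape, Shape.size]
  | node s r hs hr =>
    obtain ⟨hd, h1, h2⟩ := ht
    rw [leaves, Finset.card_union_of_disjoint hd, hs h1, hr h2, shape, Shape.size]

lemma sum_common_of_subset {t : LTree} {A : Finset ℕ} (hA : leaves t ⊆ A) :
    ∑ i ∈ A, ∑ k ∈ A, common i k t = ∑ i ∈ leaves t, ∑ k ∈ leaves t, common i k t := by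
  rw [← Finset.sum_subset hA fun i _ hi => Finset.sum_eq_zero fun k _ => common_eq_zero hi]
  refine Finset.sum_congr rfl fun i _ => ?_
  rw [← Finset.sum_subset hA fun k _ hk => by rw [common_comm, common_eq_zero hk]]

lemma sum_common {t : LTree} (ht : Proper t) :
    ∑ i ∈ leaves t, ∑ k ∈ leaves t, common i k t = t.shape.weight := by
  induction t with
  | leaf q => simp [leaves, common, shape, Shape.weight]
  | node s r hs hr =>
    obtain ⟨hd, h1, h2⟩ := ht
    simp only [leaves, common, Finset.sum_add_distrib, shape, Shape.weight]
    rw [sum_common_of_subset Finset.subset_union_left,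
      sum_common_of_subset Finset.subset_union_right, hs h1, hr h2]
    congr 1
    simp only [ite_and]
    have : ∀ i, (∑ k ∈ leaves s ∪ leaves r,
        if i ∈ leaves s then (if k ∈ leaves s then 1 else 0) else 0) =
        if i ∈ leaves s then (leaves s).card else 0 := by
      intro i
      split_ifs
      · rw [← Finset.sum_filter, ← Finset.card_eq_sum_ones]
        congr 1
        ext k; simp
      · simp
    simp only [this]
    rw [← Finset.sum_filter, Finset.sum_const, smul_eq_mul, ← card_leaves h1, sq]
    congr 2
    ext k; simp

/-- Splitting a random leaf. -/
lemma sum_ins (θ : ℝ) {t : LTree} (ht : Proper t) (n : ℕ) (F : Shape → ℂ) :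
    ∑ p ∈ leaves t, (if p = root t then (θ : ℂ) else 1) * F (ins p n t).shape =
      t.shape.gen θ F := by
  induction t generalizing θ F with
  | leaf q => simp [leaves, root, ins, shape, Shape.gen]
  | node s r hs hr =>
    obtain ⟨hd, h1, h2⟩ := ht
    rw [leaves, Finset.sum_union hd, shape, Shape.gen, ← hs 1 h1, ← hr θ h2]
    rw [Finset.disjoint_left] at hd
    congr 1
    · refine Finset.sum_congr rfl fun p hp => ?_
      have hne : p ≠ root r := fun h => hd hp (h ▸ root_mem_leaves r)
      simp [root, hne, ins, ins_of_notMem (hd hp), shape]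
    · refine Finset.sum_congr rfl fun p hp => ?_
      have hps : p ∉ leaves s := fun h => hd h hp
      simp only [root, ins, ins_of_notMem hps, shape]
      rfl

end LTree

/-- The binary tree of the recursive tree on the vertices `0, …, m`. -/
def splitTree (j : Parents) : ℕ → LTree
  | 0 => LTree.leaf 0
  | m + 1 => (splitTree j m).ins (j m) (m + 1)

lemma leaves_splitTree (j : Parents) (m : ℕ) : (splitTree j m).leaves = Finset.range (m + 1) := by
  induction m with
  | zero => rfl
  | succ m ih =>
    ext i
    have := (j m).isLt
    rw [splitTree, LTree.mem_leaves_ins, ih]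
    simp only [Finset.mem_range]
    omega

lemma proper_splitTree (j : Parents) (m : ℕ) : (splitTree j m).Proper := by
  induction m with
  | zero => trivial
  | succ m ih => exact LTree.proper_ins ih (by simp [leaves_splitTree])

lemma root_splitTree (j : Parents) (m : ℕ) : (splitTree j m).root = 0 := by
  induction m with
  | zero => rfl
  | succ m ih => rw [splitTree, LTree.root_ins, ih]

lemma dependsOn_splitTree (m : ℕ) : DependsOn (fun j => splitTree j m) (Set.Iio m) := by
  induction m with
  | zero => exact fun _ _ _ => rfl
  | succ m ih =>
    intro j j' h
    have h1 := ih.mono (Set.Iio_subset_Iio (Nat.le_succ m)) h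
    simp only [splitTree, h1, h m (Nat.lt_succ_self m)]

lemma common_splitTree (j : Parents) (m : ℕ) {i k : ℕ} (hi : i ≤ m) (hk : k ≤ m) :
    (splitTree j m).common i k = commonDepth j i k := by
  induction m generalizing i k with
  | zero =>
    obtain rfl : i = 0 := by omega
    obtain rfl : k = 0 := by omega
    simp [splitTree, LTree.common, commonDepth_zero_right]
  | succ m ih =>
    have hp : (j m : ℕ) ≤ m := Nat.lt_succ_iff.mp (j m).isLt
    have hnew : m + 1 ∉ (splitTree j m).leaves := by simp [leaves_splitTree]
    rw [splitTree]
    rcases Nat.lt_or_ge i (m + 1) with hi' | hi' <;> rcases Nat.lt_or_ge k (m + 1) with hk' | hk'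
    · rw [LTree.common_ins_of_ne _ (by omega) (by omega), ih (by omega) (by omega)]
    · obtain rfl : k = m + 1 := by omega
      rw [LTree.common_ins_new (by omega) hnew, ih (by omega) hp, commonDepth_succ j (by omega)]
    · obtain rfl : i = m + 1 := by omega
      rw [LTree.common_comm, LTree.common_ins_new (by omega) hnew, ih (by omega) hp,
        commonDepth_comm j (m + 1), commonDepth_succ j (by omega)]
    · obtain rfl : i = m + 1 := by omega
      obtain rfl : k = m + 1 := by omega
      rw [LTree.common_ins_self (proper_splitTree j m)
        (by rw [leaves_splitTree]; exact Finset.mem_range.mpr (j m).isLt) hnew,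
        ih hp hp, commonDepth_self, commonDepth_self, depth_succ]

lemma pathSum_eq_weight (j : Parents) (m : ℕ) :
    pathSum j (m + 1) = (splitTree j m).shape.weight := by
  rw [← LTree.sum_common (proper_splitTree j m), leaves_splitTree, pathSum_eq_sum]
  refine Finset.sum_congr rfl fun i hi => Finset.sum_congr rfl fun k hk => ?_
  rw [Finset.mem_range] at hi hk
  rw [common_splitTree j m (by omega) (by omega)]

lemma integral_shape {θ : ℝ} (hθ : 0 < θ) (m : ℕ) (F : Shape → ℂ) :
    ∫ j, F (splitTree j m).shape ∂hoppeMeasure θ = Shape.mean θ m F := by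
  have := isProbabilityMeasure_hoppeMeasure hθ
  induction m generalizing F with
  | zero => simp [splitTree, LTree.shape, Shape.mean]
  | succ m ih =>
    simp only [splitTree]
    rw [integral_parent hθ (f := fun j p => F ((splitTree j m).ins p (m + 1)).shape)]
    · rw [Shape.mean, ← ih, ← integral_div]
      congr 1
      funext j
      rw [← LTree.sum_ins θ (proper_splitTree j m) (m + 1), leaves_splitTree, root_splitTree,
        Finset.sum_range, Finset.sum_div]
      refine Finset.sum_congr rfl fun p _ => ?_
      have hp0 : (p : ℕ) = 0 ↔ p = 0 := by rw [Fin.ext_iff]; rfl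
      simp only [parentWeight, hp0]
      split_ifs <;> rw [Complex.real_smul] <;> push_cast <;> ring
    · intro j j' h
      have h1 := dependsOn_splitTree m h
      simp only at h1
      funext p
      simp only [h1]

section Beta

open Topology

lemma measurable_betaPDF (α β : ℝ) : Measurable (betaPDF α β) :=
  (measurable_betaPDFReal α β).ennreal_ofReal

lemma integral_betaMeasure {E : Type*} [NormedAddCommGroup E] [NormedSpace ℝ E] {α β : ℝ}
    (hα : 0 < α) (hβ : 0 < β) (f : ℝ → E) :
    ∫ v, f v ∂betaMeasure α β = ∫ v, betaPDFReal α β v • f v := by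
  have hnn : ∀ v, 0 ≤ betaPDFReal α β v := fun v => by
    by_cases hv : 0 < v ∧ v < 1
    · exact (betaPDFReal_pos hv.1 hv.2 hα hβ).le
    · rw [betaPDFReal, if_neg hv]
  rw [betaMeasure, integral_withDensity_eq_integral_toReal_smul
    (measurable_betaPDF α β) (ae_of_all _ fun v => ENNReal.ofReal_lt_top)]
  congr 1
  funext v
  rw [betaPDF, ENNReal.toReal_ofReal (hnn v)]

lemma integral_betaPDFReal {α β : ℝ} (hα : 0 < α) (hβ : 0 < β) : ∫ v, betaPDFReal α β v = 1 := by
  have := isProbabilityMeasureBeta hα hβ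
  have h := integral_betaMeasure hα hβ (fun _ => (1 : ℝ))
  simpa using h.symm

lemma ae_mem_Ioo_betaMeasure (α β : ℝ) : ∀ᵐ v ∂betaMeasure α β, v ∈ Set.Ioo (0 : ℝ) 1 := by
  rw [betaMeasure, ae_withDensity_iff (measurable_betaPDF α β)]
  refine ae_of_all _ fun v hv => ?_
  by_contra h
  exact hv (by rw [betaPDF_eq, if_neg (by exact h), ENNReal.ofReal_zero])

/-- The mixed moments of the distribution Beta(1, θ). -/
def betaMoment (θ : ℝ) (a b : ℕ) : ℝ := ∫ v, v ^ a * (1 - v) ^ b ∂betaMeasure 1 θ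

lemma betaMoment_eq {θ : ℝ} (hθ : 0 < θ) (a b : ℕ) :
    betaMoment θ a b = beta (1 + a) (θ + b) / beta 1 θ := by
  have ha : (0 : ℝ) < 1 + a := by positivity
  have hb : (0 : ℝ) < θ + b := by positivity
  have h1 := beta_pos one_pos hθ
  have h2 := beta_pos ha hb
  rw [betaMoment, integral_betaMeasure one_pos hθ]
  have : ∀ v : ℝ, betaPDFReal 1 θ v • (v ^ a * (1 - v) ^ b) =
      beta (1 + a) (θ + b) / beta 1 θ * betaPDFReal (1 + a) (θ + b) v := by
    intro v
    by_cases hv : 0 < v ∧ v < 1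
    · have hv' : 0 < 1 - v := by linarith [hv.2]
      rw [betaPDFReal, betaPDFReal, if_pos hv, if_pos hv,
        show (1 : ℝ) + a - 1 = (1 - 1) + a by ring, show θ + b - 1 = (θ - 1) + b by ring,
        Real.rpow_add hv.1, Real.rpow_add hv', Real.rpow_natCast, Real.rpow_natCast, smul_eq_mul]
      field_simp
    · rw [betaPDFReal, betaPDFReal, if_neg hv, if_neg hv]
      simp
  simp only [this]
  rw [integral_const_mul, integral_betaPDFReal ha hb, mul_one]

lemma beta_add_one_left {α β : ℝ} (hα : 0 < α) (hβ : 0 < β) :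
    beta (α + 1) β * (α + β) = beta α β * α := by
  have := (Real.Gamma_pos_of_pos (add_pos hα hβ)).ne'
  have h3 : α + β ≠ 0 := by positivity
  rw [beta, beta, Real.Gamma_add_one hα.ne', show α + 1 + β = α + β + 1 by ring,
    Real.Gamma_add_one h3]
  field_simp

lemma beta_add_one_right {α β : ℝ} (hα : 0 < α) (hβ : 0 < β) :
    beta α (β + 1) * (α + β) = beta α β * β := by
  have := (Real.Gamma_pos_of_pos (add_pos hα hβ)).ne'
  have h3 : α + β ≠ 0 := by positivity
  rw [beta, beta, Real.Gamma_add_one hβ.ne', show α + (β + 1) = α + β + 1 by ring,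
    Real.Gamma_add_one h3]
  field_simp

lemma betaMoment_zero {θ : ℝ} (hθ : 0 < θ) : betaMoment θ 0 0 = 1 := by
  rw [betaMoment_eq hθ]
  have := (beta_pos one_pos hθ).ne'
  simp [this]

lemma betaMoment_succ_left {θ : ℝ} (hθ : 0 < θ) (a b : ℕ) :
    betaMoment θ (a + 1) b * (θ + a + b + 1) = betaMoment θ a b * (a + 1) := by
  have ha : (0 : ℝ) < 1 + a := by positivity
  have hb : (0 : ℝ) < θ + b := by positivity
  have h := beta_add_one_left ha hb
  rw [betaMoment_eq hθ, betaMoment_eq hθ, div_mul_eq_mul_div, div_mul_eq_mul_div]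
  congr 1
  push_cast
  rw [← add_assoc (1 : ℝ)]
  linarith

lemma betaMoment_succ_right {θ : ℝ} (hθ : 0 < θ) (a b : ℕ) :
    betaMoment θ a (b + 1) * (θ + a + b + 1) = betaMoment θ a b * (θ + b) := by
  have ha : (0 : ℝ) < 1 + a := by positivity
  have hb : (0 : ℝ) < θ + b := by positivity
  have h := beta_add_one_right ha hb
  rw [betaMoment_eq hθ, betaMoment_eq hθ, div_mul_eq_mul_div, div_mul_eq_mul_div]
  congr 1
  push_cast
  rw [← add_assoc θ]
  linarith

lemma betaMeasure_one_one : betaMeasure 1 1 = volume.restrict (Set.Icc (0 : ℝ) 1) := by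
  have h : betaPDF 1 1 = (Set.Ioo (0 : ℝ) 1).indicator 1 := by
    funext v
    rw [betaPDF_eq]
    by_cases hv : 0 < v ∧ v < 1
    · rw [if_pos hv, Set.indicator_of_mem (by exact hv)]
      simp [beta, Real.Gamma_one, one_add_one_eq_two]
    · rw [if_neg hv, Set.indicator_of_notMem (by exact hv)]
      simp
  rw [betaMeasure, h, withDensity_indicator_one measurableSet_Ioo,
    Measure.restrict_congr_set Ioo_ae_eq_Icc]

/-- The binomial probabilities. -/
def binomialWeight (n a b : ℕ) (v : ℝ) : ℝ := n.choose a * (v ^ a * (1 - v) ^ b)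

lemma sum_binomialWeight (n : ℕ) (v : ℝ) :
    ∑ ab ∈ Finset.HasAntidiagonal.antidiagonal n, binomialWeight n ab.1 ab.2 v = 1 := by
  have h := (Commute.all v (1 - v)).add_pow' n
  rw [add_sub_cancel, one_pow] at h
  rw [h]
  simp [binomialWeight, nsmul_eq_mul]

lemma binomialWeight_nonneg (n a b : ℕ) {v : ℝ} (hv : v ∈ Set.Icc (0 : ℝ) 1) :
    0 ≤ binomialWeight n a b v := by
  have := hv.1
  have : 0 ≤ 1 - v := by linarith [hv.2]
  unfold binomialWeight
  positivity

lemma eventually_norm_bernstein_sub_le {G : ℝ → ℂ} (hG : Continuous G) {ε : ℝ} (hε : 0 < ε) :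
    ∀ᶠ n : ℕ in atTop, ∀ v ∈ Set.Icc (0 : ℝ) 1,
      ‖∑ ab ∈ Finset.HasAntidiagonal.antidiagonal n, binomialWeight n ab.1 ab.2 v •
        G ((ab.1 : ℝ) / n) - G v‖ ≤ ε := by
  set f : C(unitInterval, ℂ) := ⟨fun x => G x, hG.comp continuous_subtype_val⟩ with hf
  have h := bernsteinApproximation_uniform f
  rw [Metric.tendsto_nhds] at h
  filter_upwards [h ε hε] with n hn v hv
  have h1 := (ContinuousMap.dist_apply_le_dist (f := bernsteinApproximation n f) (g := f)
    (⟨v, hv⟩ : unitInterval)).trans hn.le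
  rw [dist_eq_norm, bernsteinApproximation.apply] at h1
  refine le_trans (le_of_eq ?_) h1
  congr 2
  rw [Finset.Nat.sum_antidiagonal_eq_sum_range_succ
    (fun a b => binomialWeight n a b v • G ((a : ℝ) / n)), Finset.sum_range]
  refine Finset.sum_congr rfl fun k _ => ?_
  rw [bernstein_apply, binomialWeight, mul_assoc]
  rfl

lemma integrable_binomialWeight {θ : ℝ} (hθ : 0 < θ) (n a b : ℕ) :
    Integrable (binomialWeight n a b) (betaMeasure 1 θ) := by
  have := isProbabilityMeasureBeta one_pos hθ
  refine Integrable.of_bound (C := n.choose a) (by unfold binomialWeight; fun_prop) ?_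
  filter_upwards [ae_mem_Ioo_betaMeasure 1 θ] with v hv
  have h0 := hv.1.le
  have h1 : 0 ≤ 1 - v := by linarith [hv.2]
  rw [Real.norm_of_nonneg (binomialWeight_nonneg n a b ⟨hv.1.le, hv.2.le⟩), binomialWeight]
  exact mul_le_of_le_one_right (by positivity) (mul_le_one₀ (pow_le_one₀ h0 hv.2.le)
    (by positivity) (pow_le_one₀ h1 (by linarith)))

/-- The law of large numbers for the Pólya urn, in terms of a continuous function. -/
lemma tendsto_sum_betaMoment {θ : ℝ} (hθ : 0 < θ) {G : ℝ → ℂ} (hG : Continuous G)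
    {x : ℕ → ℕ → ℕ → ℂ} (hx : ∀ ε : ℝ, 0 < ε → ∀ᶠ n : ℕ in atTop, ∀ a b : ℕ, a + b = n →
      ‖x n a b - G ((a : ℝ) / n)‖ ≤ ε) :
    Tendsto (fun n : ℕ => ∑ ab ∈ Finset.HasAntidiagonal.antidiagonal n, (n.choose ab.1 : ℂ) *
      (betaMoment θ ab.1 ab.2 * x n ab.1 ab.2)) atTop (𝓝 (∫ v, G v ∂betaMeasure 1 θ)) := by
  have := isProbabilityMeasureBeta one_pos hθ
  have hsupp := ae_mem_Ioo_betaMeasure 1 θ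
  obtain ⟨C, hC⟩ := (isCompact_Icc (a := (0 : ℝ)) (b := 1)).exists_bound_of_continuousOn
    hG.continuousOn
  have iG : Integrable G (betaMeasure 1 θ) := by
    refine Integrable.of_bound (C := C) (by fun_prop) ?_
    filter_upwards [hsupp] with v hv
    exact hC v ⟨hv.1.le, hv.2.le⟩
  rw [Metric.tendsto_nhds]
  intro ε hε
  filter_upwards [hx (ε / 3) (by positivity),
    eventually_norm_bernstein_sub_le hG (by positivity : 0 < ε / 3)] with n h1 h2
  have i1 : ∀ ab ∈ Finset.HasAntidiagonal.antidiagonal n, Integrable (fun v =>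
      binomialWeight n ab.1 ab.2 v • x n ab.1 ab.2) (betaMeasure 1 θ) :=
    fun ab _ => (integrable_binomialWeight hθ n ab.1 ab.2).smul_const _
  have e : ∑ ab ∈ Finset.HasAntidiagonal.antidiagonal n, (n.choose ab.1 : ℂ) *
      (betaMoment θ ab.1 ab.2 * x n ab.1 ab.2) =
      ∫ v, ∑ ab ∈ Finset.HasAntidiagonal.antidiagonal n,
        binomialWeight n ab.1 ab.2 v • x n ab.1 ab.2 ∂betaMeasure 1 θ := by
    rw [integral_finsetSum _ i1]
    refine Finset.sum_congr rfl fun ab _ => ?_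
    rw [integral_smul_const]
    simp only [binomialWeight]
    rw [integral_const_mul, ← betaMoment, Complex.real_smul]
    push_cast
    ring
  rw [e, dist_eq_norm, ← integral_sub (integrable_finsetSum _ i1) iG]
  have hle : ‖∫ v, (∑ ab ∈ Finset.HasAntidiagonal.antidiagonal n,
      binomialWeight n ab.1 ab.2 v • x n ab.1 ab.2 - G v) ∂betaMeasure 1 θ‖ ≤
      (ε / 3 + ε / 3) * (betaMeasure 1 θ).real Set.univ := by
    refine norm_integral_le_of_norm_le_const ?_
    filter_upwards [hsupp] with v hv
    have hv' : v ∈ Set.Icc (0 : ℝ) 1 := ⟨hv.1.le, hv.2.le⟩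
    have e2 : ∑ ab ∈ Finset.HasAntidiagonal.antidiagonal n,
        binomialWeight n ab.1 ab.2 v • x n ab.1 ab.2 - G v =
        ∑ ab ∈ Finset.HasAntidiagonal.antidiagonal n,
          binomialWeight n ab.1 ab.2 v • (x n ab.1 ab.2 - G ((ab.1 : ℝ) / n)) +
        (∑ ab ∈ Finset.HasAntidiagonal.antidiagonal n,
          binomialWeight n ab.1 ab.2 v • G ((ab.1 : ℝ) / n) - G v) := by
      simp only [smul_sub, Finset.sum_sub_distrib]
      ring
    rw [e2]
    refine (norm_add_le _ _).trans (add_le_add ?_ (h2 v hv'))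
    refine (norm_sum_le _ _).trans ?_
    calc _ ≤ ∑ ab ∈ Finset.HasAntidiagonal.antidiagonal n,
          binomialWeight n ab.1 ab.2 v * (ε / 3) := by
          refine Finset.sum_le_sum fun ab hab => ?_
          rw [norm_smul, Real.norm_of_nonneg (binomialWeight_nonneg _ _ _ hv')]
          exact mul_le_mul_of_nonneg_left
            (h1 _ _ (Finset.HasAntidiagonal.mem_antidiagonal.mp hab))
            (binomialWeight_nonneg _ _ _ hv')
      _ = ε / 3 := by rw [← Finset.sum_mul, sum_binomialWeight, one_mul]
  rw [probReal_univ, mul_one] at hle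
  linarith

end Beta

section Fixpoint

open Topology

lemma norm_cexp_mul_I_sub_le (x y : ℝ) :
    ‖Complex.exp (x * Complex.I) - Complex.exp (y * Complex.I)‖ ≤ |x - y| := by
  have e : Complex.exp (x * Complex.I) - Complex.exp (y * Complex.I) =
      Complex.exp (y * Complex.I) * (Complex.exp (Complex.I * ((x - y : ℝ) : ℂ)) - 1) := by
    rw [mul_sub, ← Complex.exp_add, mul_one]
    congr 2
    push_cast
    ring
  rw [e, norm_mul, Complex.norm_exp_ofReal_mul_I, one_mul]
  exact Real.norm_exp_I_mul_ofReal_sub_one_le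

lemma norm_charFun_map_sub_le {Ω : Type*} [MeasurableSpace Ω] {P : Measure Ω}
    [IsProbabilityMeasure P] {X Y : Ω → ℝ} (hX : Measurable X) (hY : Measurable Y)
    (iX : Integrable X P) (iY : Integrable Y P) (s : ℝ) :
    ‖charFun (P.map X) s - charFun (P.map Y) s‖ ≤ |s| * ∫ ω, |X ω - Y ω| ∂P := by
  have hm : ∀ Z : Ω → ℝ, Measurable Z →
      Integrable (fun ω => Complex.exp (s * Z ω * Complex.I)) P := fun Z hZ => by
    refine Integrable.of_bound (C := 1) (by fun_prop) (ae_of_all _ fun ω => ?_)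
    rw [← Complex.ofReal_mul, Complex.norm_exp_ofReal_mul_I]
  rw [charFun_apply_real, charFun_apply_real, integral_map hX.aemeasurable (by fun_prop),
    integral_map hY.aemeasurable (by fun_prop), ← integral_sub (hm X hX) (hm Y hY),
    ← integral_const_mul]
  refine norm_integral_le_of_norm_le ((iX.sub iY).abs.const_mul _) (ae_of_all _ fun ω => ?_)
  have := norm_cexp_mul_I_sub_le (s * X ω) (s * Y ω)
  rw [← mul_sub, abs_mul] at this
  exact_mod_cast this

/-- `μ` is the weak limit of the laws of `U_n / n ^ 2`, with a rate for the characteristic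
functions. -/
def IsLimitLaw (θ : ℝ) (μ : Measure ℝ) : Prop :=
  ∃ ε : ℕ → ℝ, Tendsto ε atTop (𝓝 0) ∧ ∀ n s,
    ‖charFun ((hoppeMeasure θ).map (scaledSum n)) s - charFun μ s‖ ≤ |s| * ε n

theorem exists_isLimitLaw {θ : ℝ} (hθ : 0 < θ) : ∃ μ : Measure ℝ, IsProbabilityMeasure μ ∧
    IsLimitLaw θ μ ∧ MemLp id 2 μ ∧ ∫ u, u ∂μ = 2 / (1 + θ) ∧ ∀ᵐ u ∂μ, 0 ≤ u := by
  have := isProbabilityMeasure_hoppeMeasure hθ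
  obtain ⟨Z, hZm, hZ2, hmean, hnn, hlim⟩ := exists_limit hθ
  refine ⟨(hoppeMeasure θ).map Z, Measure.isProbabilityMeasure_map hZm.aemeasurable,
    ⟨_, hlim, fun n s => ?_⟩, ?_, ?_, ?_⟩
  · exact norm_charFun_map_sub_le (measurable_scaledSum n) hZm (integrable_scaledSum hθ n)
      (hZ2.integrable one_le_two) s
  · rw [memLp_map_measure_iff (by fun_prop) hZm.aemeasurable]
    exact hZ2
  · rw [integral_map hZm.aemeasurable (by fun_prop), hmean]
  · rw [ae_map_iff hZm.aemeasurable measurableSet_Ici]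
    exact hnn

lemma charFun_scaledSum {θ : ℝ} (hθ : 0 < θ) (m : ℕ) (s : ℝ) :
    charFun ((hoppeMeasure θ).map (scaledSum (m + 1))) s =
      Shape.mean θ m fun t => Complex.exp ((s / (m + 1) ^ 2 * t.weight : ℝ) * Complex.I) := by
  rw [charFun_apply_real, integral_map (measurable_scaledSum _).aemeasurable (by fun_prop),
    ← integral_shape hθ]
  congr 1
  funext j
  rw [scaledSum, pathSum_eq_weight]
  congr 2
  push_cast
  ring

lemma mean_split {θ : ℝ} (a b : ℕ) (τ : ℝ) :
    Shape.mean 1 a (fun s => Shape.mean θ b (fun r =>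
      Complex.exp ((τ * (Shape.node s r).weight : ℝ) * Complex.I))) =
    Complex.exp ((τ * ((a : ℝ) + 1) ^ 2 : ℝ) * Complex.I) *
      (Shape.mean 1 a (fun s => Complex.exp ((τ * s.weight : ℝ) * Complex.I)) *
      Shape.mean θ b (fun r => Complex.exp ((τ * r.weight : ℝ) * Complex.I))) := by
  have e : ∀ s r : Shape, Complex.exp ((τ * (Shape.node s r).weight : ℝ) * Complex.I) =
      Complex.exp ((τ * (s.size : ℝ) ^ 2 : ℝ) * Complex.I) *
      Complex.exp ((τ * s.weight : ℝ) * Complex.I) *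
      Complex.exp ((τ * r.weight : ℝ) * Complex.I) := by
    intro s r
    rw [← Complex.exp_add, ← Complex.exp_add, Shape.weight]
    congr 1
    push_cast
    ring
  simp only [e, Shape.mean_mul_left, Shape.mean_mul_right]
  rw [← mul_assoc]
  congr 1
  rw [← Shape.mean_mul_left]
  refine Shape.mean_congr 1 a fun s hs => ?_
  rw [hs]
  push_cast
  rfl

/-- The recursion for the characteristic functions of `U_n / n ^ 2`. -/
lemma charFun_scaledSum_add_two {θ : ℝ} (hθ : 0 < θ) (n : ℕ) (s : ℝ) :
    charFun ((hoppeMeasure θ).map (scaledSum (n + 2))) s =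
    ∑ ab ∈ Finset.HasAntidiagonal.antidiagonal n, (n.choose ab.1 : ℂ) *
      (betaMoment θ ab.1 ab.2 *
        (Complex.exp ((s * (((ab.1 : ℝ) + 1) / (n + 2)) ^ 2 : ℝ) * Complex.I) *
        (charFun ((hoppeMeasure 1).map (scaledSum (ab.1 + 1)))
          (s * (((ab.1 : ℝ) + 1) / (n + 2)) ^ 2) *
        charFun ((hoppeMeasure θ).map (scaledSum (ab.2 + 1)))
          (s * (((ab.2 : ℝ) + 1) / (n + 2)) ^ 2)))) := by
  rw [charFun_scaledSum hθ, Shape.mean_succ_eq_sum hθ (betaMoment_zero hθ)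
    (betaMoment_succ_left hθ) (betaMoment_succ_right hθ)]
  refine Finset.sum_congr rfl fun ab _ => ?_
  obtain ⟨a, b⟩ := ab
  simp only
  have h : ∀ c : ℕ, s * (((c : ℝ) + 1) / (n + 2)) ^ 2 / (c + 1) ^ 2 =
      s / (((n + 1 : ℕ) : ℝ) + 1) ^ 2 := by
    intro c
    have : (c : ℝ) + 1 ≠ 0 := by positivity
    push_cast
    field_simp
    ring
  rw [charFun_scaledSum one_pos, charFun_scaledSum hθ, h, h, mean_split]
  congr 5
  push_cast
  field_simp
  ring

lemma eventually_scaled_le {e : ℕ → ℝ} (he : Tendsto e atTop (𝓝 0)) {δ : ℝ}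
    (hδ : 0 < δ) : ∀ᶠ n : ℕ in atTop, ∀ a ≤ n, (((a : ℝ) + 1) / (n + 2)) ^ 2 * e (a + 1) ≤ δ := by
  obtain ⟨B, hB⟩ := he.bddAbove_range
  obtain ⟨K, hK⟩ := eventually_atTop.mp (he.eventually_le_const hδ)
  have hlim : Tendsto (fun n : ℕ => (K : ℝ) * (1 / ((n : ℝ) + 1)) * |B|) atTop (𝓝 0) := by
    simpa using (tendsto_one_div_add_atTop_nhds_zero_nat.const_mul (K : ℝ)).mul_const |B|
  filter_upwards [hlim.eventually_le_const hδ] with n hn a ha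
  have ha' : (a : ℝ) ≤ n := by exact_mod_cast ha
  have h0 : 0 ≤ ((a : ℝ) + 1) / (n + 2) := by positivity
  have h1 : ((a : ℝ) + 1) / (n + 2) ≤ 1 := by
    rw [div_le_one (by positivity)]
    linarith
  rcases le_or_gt K (a + 1) with h | h
  · exact (mul_le_mul_of_nonneg_left (hK _ h) (by positivity)).trans
      (mul_le_of_le_one_left hδ.le (pow_le_one₀ h0 h1))
  · have hle : e (a + 1) ≤ |B| := (hB ⟨a + 1, rfl⟩).trans (le_abs_self B)
    have haK : (a : ℝ) + 1 ≤ K := by exact_mod_cast h.le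
    calc (((a : ℝ) + 1) / (n + 2)) ^ 2 * e (a + 1)
        ≤ (((a : ℝ) + 1) / (n + 2)) ^ 2 * |B| := by gcongr
      _ ≤ (((a : ℝ) + 1) / (n + 2)) * |B| := by
          gcongr
          exact pow_le_of_le_one h0 h1 two_ne_zero
      _ ≤ (K : ℝ) * (1 / ((n : ℝ) + 1)) * |B| := by
          rw [mul_one_div]
          gcongr
          linarith
      _ ≤ δ := hn

lemma norm_mul_mul_sub_le {u x y x' y' : ℂ} (hu : ‖u‖ ≤ 1) (hx : ‖x'‖ ≤ 1) (hy : ‖y‖ ≤ 1) :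
    ‖u * (x * y) - u * (x' * y')‖ ≤ ‖x - x'‖ + ‖y - y'‖ := by
  have e : u * (x * y) - u * (x' * y') = u * ((x - x') * y + x' * (y - y')) := by ring
  rw [e, norm_mul]
  refine (mul_le_of_le_one_left (norm_nonneg _) hu).trans ((norm_add_le _ _).trans ?_)
  rw [norm_mul, norm_mul]
  exact add_le_add (mul_le_of_le_one_right (norm_nonneg _) hy)
    (mul_le_of_le_one_left (norm_nonneg _) hx)

lemma IsLimitLaw.tendsto_charFun {θ : ℝ} {μ : Measure ℝ} (h : IsLimitLaw θ μ) (s : ℝ) :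
    Tendsto (fun n => charFun ((hoppeMeasure θ).map (scaledSum n)) s) atTop
      (𝓝 (charFun μ s)) := by
  obtain ⟨ε, hε, hb⟩ := h
  rw [tendsto_iff_norm_sub_tendsto_zero]
  refine squeeze_zero (fun _ => norm_nonneg _) (fun n => hb n s) ?_
  simpa using hε.const_mul |s|

lemma charFun_eq_integral_beta {θ : ℝ} (hθ : 0 < θ) {μ μ' : Measure ℝ} [IsProbabilityMeasure μ]
    [IsProbabilityMeasure μ'] (h : IsLimitLaw 1 μ) (h' : IsLimitLaw θ μ') (s : ℝ) :
    charFun μ' s = ∫ v, Complex.exp ((s * v ^ 2 : ℝ) * Complex.I) *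
      (charFun μ (s * v ^ 2) * charFun μ' (s * (1 - v) ^ 2)) ∂betaMeasure 1 θ := by
  have := isProbabilityMeasure_hoppeMeasure hθ
  have := isProbabilityMeasure_hoppeMeasure one_pos
  set G : ℝ → ℂ := fun v => Complex.exp ((s * v ^ 2 : ℝ) * Complex.I) *
      (charFun μ (s * v ^ 2) * charFun μ' (s * (1 - v) ^ 2)) with hGdef
  have hG : Continuous G := by
    have h1 : Continuous (charFun μ) := by fun_prop
    have h2 : Continuous (charFun μ') := by fun_prop
    have h3 : Continuous fun v : ℝ => charFun μ (s * v ^ 2) := h1.comp (by fun_prop)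
    have h4 : Continuous fun v : ℝ => charFun μ' (s * (1 - v) ^ 2) := h2.comp (by fun_prop)
    exact Continuous.mul (by fun_prop) (h3.mul h4)
  have hlim := (tendsto_add_atTop_iff_nat 2).mpr (h'.tendsto_charFun s)
  simp only [charFun_scaledSum_add_two hθ] at hlim
  refine tendsto_nhds_unique hlim (tendsto_sum_betaMoment hθ hG (x := fun n a b =>
    Complex.exp ((s * (((a : ℝ) + 1) / (n + 2)) ^ 2 : ℝ) * Complex.I) *
      (charFun ((hoppeMeasure 1).map (scaledSum (a + 1))) (s * (((a : ℝ) + 1) / (n + 2)) ^ 2) *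
      charFun ((hoppeMeasure θ).map (scaledSum (b + 1)))
        (s * (((b : ℝ) + 1) / (n + 2)) ^ 2))) ?_)
  intro δ hδ
  obtain ⟨ε, hε, hb⟩ := h
  obtain ⟨ε', hε', hb'⟩ := h'
  have huc := (isCompact_Icc (a := (0 : ℝ)) (b := 1)).uniformContinuousOn_of_continuous
    hG.continuousOn
  obtain ⟨η, hη, hGη⟩ := Metric.uniformContinuousOn_iff_le.mp huc (δ / 3) (by positivity)
  have hs : 0 < |s| + 1 := by positivity
  filter_upwards [eventually_scaled_le hε (by positivity : 0 < δ / 3 / (|s| + 1)),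
    eventually_scaled_le hε' (by positivity : 0 < δ / 3 / (|s| + 1)),
    (tendsto_one_div_add_atTop_nhds_zero_nat (𝕜 := ℝ)).eventually_le_const hη,
    eventually_gt_atTop 0] with n h1 h2 h3 hn0 a b hab
  have hn : (0 : ℝ) < n := by exact_mod_cast hn0
  have habR : (a : ℝ) + b = n := by exact_mod_cast hab
  have ha0 : (0 : ℝ) ≤ a := by positivity
  have hb0 : (0 : ℝ) ≤ b := by positivity
  set u : ℝ := ((a : ℝ) + 1) / (n + 2) with hu
  have hub : ((b : ℝ) + 1) / (n + 2) = 1 - u := by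
    rw [hu, ← habR]
    field_simp
    ring
  have hu_mem : u ∈ Set.Icc (0 : ℝ) 1 := by
    refine ⟨by positivity, ?_⟩
    rw [hu, div_le_one (by positivity)]
    linarith
  have ha_mem : (a : ℝ) / n ∈ Set.Icc (0 : ℝ) 1 := by
    refine ⟨by positivity, ?_⟩
    rw [div_le_one hn]
    linarith
  have hclose : dist u ((a : ℝ) / n) ≤ η := by
    refine le_trans ?_ h3
    have e : u - (a : ℝ) / n = ((b : ℝ) - a) / (n * (n + 2)) := by
      rw [hu, ← habR]
      have : (a : ℝ) + b ≠ 0 := by rw [habR]; exact hn.ne'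
      field_simp
      ring
    have hba : |(b : ℝ) - a| ≤ n := by
      rw [abs_le]
      constructor <;> linarith
    rw [Real.dist_eq, e, abs_div, abs_of_pos (by positivity : (0 : ℝ) < n * (n + 2)),
      div_le_div_iff₀ (by positivity) (by positivity)]
    nlinarith
  have hscale : ∀ {w E : ℝ}, w ^ 2 * E ≤ δ / 3 / (|s| + 1) → |s * w ^ 2| * E ≤ δ / 3 := by
    intro w E hE
    rw [abs_mul, abs_of_nonneg (sq_nonneg w), mul_assoc]
    calc |s| * (w ^ 2 * E) ≤ |s| * (δ / 3 / (|s| + 1)) := by gcongr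
      _ ≤ (|s| + 1) * (δ / 3 / (|s| + 1)) := by gcongr; linarith
      _ = δ / 3 := by field_simp
  have hA := (hb (a + 1) (s * u ^ 2)).trans (hscale (h1 a (by omega)))
  have hB := (hb' (b + 1) (s * (1 - u) ^ 2)).trans (hscale (by rw [← hub]; exact h2 b (by omega)))
  have hfirst := norm_mul_mul_sub_le
    (u := Complex.exp ((s * u ^ 2 : ℝ) * Complex.I))
    (x := charFun ((hoppeMeasure 1).map (scaledSum (a + 1))) (s * u ^ 2))
    (y := charFun ((hoppeMeasure θ).map (scaledSum (b + 1))) (s * (1 - u) ^ 2))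
    (x' := charFun μ (s * u ^ 2)) (y' := charFun μ' (s * (1 - u) ^ 2))
    (Complex.norm_exp_ofReal_mul_I _).le (norm_charFun_le_one _) (by
      have := Measure.isProbabilityMeasure_map (μ := hoppeMeasure θ)
        (measurable_scaledSum (b + 1)).aemeasurable
      exact norm_charFun_le_one _)
  have hsecond := hGη u hu_mem _ ha_mem hclose
  rw [dist_eq_norm] at hsecond
  rw [hub]
  calc _ ≤ _ := norm_sub_le_norm_sub_add_norm_sub _ (G u) _
    _ ≤ (δ / 3 + δ / 3) + δ / 3 := add_le_add (hfirst.trans (add_le_add hA hB)) hsecond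
    _ = δ := by ring

/-- The characteristic function of a random affine combination of independent variables. -/
lemma charFun_map_affine {μ μ' β : Measure ℝ} [IsProbabilityMeasure μ] [IsProbabilityMeasure μ']
    [IsProbabilityMeasure β] {A B C : ℝ → ℝ} (hA : Continuous A) (hB : Continuous B)
    (hC : Continuous C) (s : ℝ) :
    charFun ((μ'.prod (μ.prod β)).map
      fun p => A p.2.2 * p.1 + B p.2.2 * p.2.1 + C p.2.2) s =
    ∫ v, Complex.exp ((s * C v : ℝ) * Complex.I) *
      (charFun μ (s * B v) * charFun μ' (s * A v)) ∂β := by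
  have hf : Continuous fun p : ℝ × ℝ × ℝ => A p.2.2 * p.1 + B p.2.2 * p.2.1 + C p.2.2 := by
    fun_prop
  set f : ℝ × ℝ × ℝ → ℂ := fun p =>
    Complex.exp ((s * (A p.2.2 * p.1 + B p.2.2 * p.2.1 + C p.2.2) : ℝ) * Complex.I) with hfdef
  have hfc : Continuous f := by fun_prop
  have hint : Integrable f (μ'.prod (μ.prod β)) :=
    Integrable.of_bound (C := 1) (by fun_prop)
      (ae_of_all _ fun p => (Complex.norm_exp_ofReal_mul_I _).le)
  rw [charFun_apply_real, integral_map hf.aemeasurable (by fun_prop)]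
  have e1 : ∀ p : ℝ × ℝ × ℝ, Complex.exp (s * ((A p.2.2 * p.1 + B p.2.2 * p.2.1 + C p.2.2 : ℝ) : ℂ) *
      Complex.I) = f p := fun p => by simp only [hfdef]; push_cast; rfl
  simp only [e1]
  have e2 : ∀ x y v : ℝ, f (x, y, v) = Complex.exp ((s * C v : ℝ) * Complex.I) *
      (Complex.exp ((s * B v : ℝ) * y * Complex.I) *
        Complex.exp ((s * A v : ℝ) * x * Complex.I)) := by
    intro x y v
    simp only [hfdef]
    rw [← Complex.exp_add, ← Complex.exp_add]
    congr 1
    push_cast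
    ring
  rw [integral_prod_symm _ hint, integral_prod_symm _ hint.integral_prod_right]
  refine integral_congr_ae (ae_of_all _ fun v => ?_)
  simp only [e2, integral_const_mul, integral_mul_const, charFun_apply_real]

lemma isHoppeFixpoint_of_isLimitLaw {θ : ℝ} (hθ : 0 < θ) {μ μ' : Measure ℝ}
    [IsProbabilityMeasure μ] [IsProbabilityMeasure μ'] (h : IsLimitLaw 1 μ)
    (h' : IsLimitLaw θ μ') : IsHoppeFixpoint θ μ μ' := by
  have := isProbabilityMeasureBeta one_pos hθ
  refine Measure.ext_of_charFun ?_
  funext s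
  rw [charFun_eq_integral_beta hθ h h', charFun_map_affine (A := fun v => (1 - v) ^ 2)
    (B := fun v => v ^ 2) (C := fun v => v ^ 2) (by fun_prop) (by fun_prop) (by fun_prop)]

lemma isRecursiveFixpoint_of_isLimitLaw {μ : Measure ℝ} [IsProbabilityMeasure μ]
    (h : IsLimitLaw 1 μ) : IsRecursiveFixpoint μ := by
  have := isProbabilityMeasureBeta one_pos one_pos
  rw [IsRecursiveFixpoint, ← betaMeasure_one_one]
  refine Measure.ext_of_charFun ?_
  funext s
  rw [charFun_eq_integral_beta one_pos h h, charFun_map_affine (A := fun v => v ^ 2)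
    (B := fun v => (1 - v) ^ 2) (C := fun v => v ^ 2) (by fun_prop) (by fun_prop) (by fun_prop)]
  simp only [mul_comm (charFun μ (s * (1 - _) ^ 2))]

end Fixpoint

section SecondMoment

lemma betaMoment_zero_four {θ : ℝ} (hθ : 0 < θ) : betaMoment θ 0 4 = θ / (θ + 4) := by
  have h0 := betaMoment_zero hθ
  have h1 := betaMoment_succ_right hθ 0 0
  have h2 := betaMoment_succ_right hθ 0 1
  have h3 := betaMoment_succ_right hθ 0 2
  have h4 := betaMoment_succ_right hθ 0 3
  norm_num at h1 h2 h3 h4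
  rw [h0, ← eq_div_iff (by positivity)] at h1
  rw [h1, ← eq_div_iff (by positivity)] at h2
  rw [h2, ← eq_div_iff (by positivity)] at h3
  rw [h3, ← eq_div_iff (by positivity)] at h4
  rw [h4]
  field_simp
  ring

lemma betaMoment_two_zero {θ : ℝ} (hθ : 0 < θ) :
    betaMoment θ 2 0 = 2 / ((θ + 1) * (θ + 2)) := by
  have h0 := betaMoment_zero hθ
  have h1 := betaMoment_succ_left hθ 0 0
  have h2 := betaMoment_succ_left hθ 1 0
  norm_num at h1 h2
  rw [h0, ← eq_div_iff (by positivity)] at h1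
  rw [h1, ← eq_div_iff (by positivity)] at h2
  rw [h2]
  field_simp
  ring

lemma betaMoment_four_zero {θ : ℝ} (hθ : 0 < θ) :
    betaMoment θ 4 0 = 24 / ((θ + 1) * (θ + 2) * (θ + 3) * (θ + 4)) := by
  have h0 := betaMoment_two_zero hθ
  have h1 := betaMoment_succ_left hθ 2 0
  have h2 := betaMoment_succ_left hθ 3 0
  norm_num at h1 h2
  rw [h0, ← eq_div_iff (by positivity)] at h1
  rw [h1, ← eq_div_iff (by positivity)] at h2
  rw [h2]
  field_simp
  ring

lemma betaMoment_two_two {θ : ℝ} (hθ : 0 < θ) :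
    betaMoment θ 2 2 = 2 * θ / ((θ + 2) * (θ + 3) * (θ + 4)) := by
  have h0 := betaMoment_two_zero hθ
  have h1 := betaMoment_succ_right hθ 2 0
  have h2 := betaMoment_succ_right hθ 2 1
  norm_num at h1 h2
  rw [h0, ← eq_div_iff (by positivity)] at h1
  rw [h1, ← eq_div_iff (by positivity)] at h2
  rw [h2]
  field_simp
  ring

lemma integrable_betaMoment {θ : ℝ} (hθ : 0 < θ) (a b : ℕ) :
    Integrable (fun v => v ^ a * (1 - v) ^ b) (betaMeasure 1 θ) := by
  have h : binomialWeight a a b = fun v => v ^ a * (1 - v) ^ b := by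
    funext v
    simp [binomialWeight]
  exact h ▸ integrable_binomialWeight hθ a a b

/-- The second moment of a square integrable solution of the fixed point equation. -/
lemma IsHoppeFixpoint.integral_sq {θ : ℝ} (hθ : 0 < θ) {μ μ' : Measure ℝ}
    [IsProbabilityMeasure μ] [IsProbabilityMeasure μ'] (h : IsHoppeFixpoint θ μ μ')
    (hμ : MemLp id 2 μ) (hμ' : MemLp id 2 μ') :
    ∫ u, u ^ 2 ∂μ' = betaMoment θ 0 4 * ∫ u, u ^ 2 ∂μ' +
      betaMoment θ 4 0 * (∫ u, u ^ 2 ∂μ + 1 + 2 * ∫ u, u ∂μ) +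
      betaMoment θ 2 2 * (2 * (∫ u, u ∂μ') * ∫ u, u ∂μ + 2 * ∫ u, u ∂μ') := by
  have := isProbabilityMeasureBeta one_pos hθ
  have i1 : Integrable (fun u : ℝ => u ^ 1) μ := by
    simp only [pow_one]; exact hμ.integrable one_le_two
  have i1' : Integrable (fun u : ℝ => u ^ 1) μ' := by
    simp only [pow_one]; exact hμ'.integrable one_le_two
  have i2 : Integrable (fun u : ℝ => u ^ 2) μ := hμ.integrable_sq
  have i2' : Integrable (fun u : ℝ => u ^ 2) μ' := hμ'.integrable_sq
  have i0 : Integrable (fun u : ℝ => u ^ 0) μ := by simp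
  have i0' : Integrable (fun u : ℝ => u ^ 0) μ' := by simp
  set F : ℕ → ℕ → ℕ → ℕ → ℝ × ℝ × ℝ → ℝ := fun k l a b p =>
    p.1 ^ k * (p.2.1 ^ l * (p.2.2 ^ a * (1 - p.2.2) ^ b)) with hF
  have hint : ∀ k l a b, Integrable (fun u : ℝ => u ^ k) μ' → Integrable (fun u : ℝ => u ^ l) μ →
      Integrable (F k l a b) (μ'.prod (μ.prod (betaMeasure 1 θ))) := fun k l a b hk hl =>
    hk.mul_prod (hl.mul_prod (integrable_betaMoment hθ a b))
  have hval : ∀ k l a b, ∫ p, F k l a b p ∂(μ'.prod (μ.prod (betaMeasure 1 θ))) =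
      (∫ u, u ^ k ∂μ') * ((∫ u, u ^ l ∂μ) * betaMoment θ a b) := by
    intro k l a b
    rw [betaMoment, ← integral_prod_mul, ← integral_prod_mul]
  have hmeas : Measurable fun p : ℝ × ℝ × ℝ =>
      (1 - p.2.2) ^ 2 * p.1 + p.2.2 ^ 2 * p.2.1 + p.2.2 ^ 2 := by fun_prop
  have hsq : ∀ p : ℝ × ℝ × ℝ,
      ((1 - p.2.2) ^ 2 * p.1 + p.2.2 ^ 2 * p.2.1 + p.2.2 ^ 2) ^ 2 =
      F 2 0 0 4 p + (F 0 2 4 0 p + F 0 0 4 0 p + 2 * F 0 1 4 0 p) +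
        (2 * F 1 1 2 2 p + 2 * F 1 0 2 2 p) := by
    intro p
    simp only [hF]
    ring
  have j1 := hint 2 0 0 4 i2' i0
  have j2 := hint 0 2 4 0 i0' i2
  have j3 := hint 0 0 4 0 i0' i0
  have j4 := (hint 0 1 4 0 i0' i1).const_mul 2
  have j5 := (hint 1 1 2 2 i1' i1).const_mul 2
  have j6 := (hint 1 0 2 2 i1' i0).const_mul 2
  have hmain : ∫ u, u ^ 2 ∂μ' =
      ∫ p, ((1 - p.2.2) ^ 2 * p.1 + p.2.2 ^ 2 * p.2.1 + p.2.2 ^ 2) ^ 2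
        ∂(μ'.prod (μ.prod (betaMeasure 1 θ))) := by
    conv_lhs => rw [h]
    rw [integral_map hmeas.aemeasurable (by fun_prop)]
  refine hmain.trans ?_
  simp only [hsq]
  rw [integral_add (by exact j1.add ((j2.add j3).add j4)) (by exact j5.add j6),
    integral_add j1 (by exact (j2.add j3).add j4), integral_add (by exact j2.add j3) j4,
    integral_add j2 j3, integral_add j5 j6, integral_const_mul, integral_const_mul,
    integral_const_mul, hval, hval, hval, hval, hval, hval]
  simp
  ring

lemma integral_sq_of_isRecursive {μ : Measure ℝ} [IsProbabilityMeasure μ]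
    (h : IsHoppeFixpoint 1 μ μ) (hμ : MemLp id 2 μ) (h1 : ∫ u, u ∂μ = 1) :
    ∫ u, u ^ 2 ∂μ = 11 / 9 := by
  have e := h.integral_sq one_pos hμ hμ
  rw [betaMoment_zero_four one_pos, betaMoment_four_zero one_pos, betaMoment_two_two one_pos,
    h1] at e
  norm_num at e
  linarith

lemma integral_sq_of_isHoppe {θ : ℝ} (hθ : 0 < θ) {μ μ' : Measure ℝ} [IsProbabilityMeasure μ]
    [IsProbabilityMeasure μ'] (h : IsHoppeFixpoint θ μ μ') (hμ : MemLp id 2 μ)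
    (hμ' : MemLp id 2 μ') (h1 : ∫ u, u ∂μ = 1) (h2 : ∫ u, u ^ 2 ∂μ = 11 / 9)
    (h1' : ∫ u, u ∂μ' = 2 / (1 + θ)) :
    ∫ u, u ^ 2 ∂μ' = (12 * θ + 76) / (3 * (1 + θ) * (2 + θ) * (3 + θ)) := by
  have e := h.integral_sq hθ hμ hμ'
  rw [betaMoment_zero_four hθ, betaMoment_four_zero hθ, betaMoment_two_two hθ, h1, h2, h1'] at e
  set q := ∫ u, u ^ 2 ∂μ'
  rw [eq_div_iff (by positivity)]
  have e2 : q * (4 / (θ + 4)) =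
      24 / ((θ + 1) * (θ + 2) * (θ + 3) * (θ + 4)) * (11 / 9 + 1 + 2 * 1) +
      2 * θ / ((θ + 2) * (θ + 3) * (θ + 4)) * (2 * (2 / (1 + θ)) * 1 + 2 * (2 / (1 + θ))) := by
    have : q * (4 / (θ + 4)) = q - θ / (θ + 4) * q := by field_simp; ring
    rw [this]
    linarith
  rw [add_comm 1 θ] at e2
  field_simp at e2
  linarith

end SecondMoment

section Barycentre

/-- If `X` has the regular conditional distribution `κ (Y, ·)` given `𝓗` on an event `A ∈ 𝓗`, then
the joint law of `(Y, X)` on `A` is the law of `Y` composed with `κ`. -/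
lemma map_restrict_eq_compProd {Ω β : Type*} {𝓗 mΩ : MeasurableSpace Ω} [MeasurableSpace β]
    {P : Measure Ω} [IsProbabilityMeasure P] (h𝓗 : 𝓗 ≤ mΩ) {A : Set Ω} (hA : MeasurableSet[𝓗] A)
    {Y : Ω → β} (hY : Measurable[𝓗] Y) {X : Ω → ℝ} (hX : Measurable X) {κ : Kernel β ℝ}
    [IsMarkovKernel κ] {K : Set ℝ → Ω → ℝ}
    (hK : ∀ B, MeasurableSet B → P⟦X ⁻¹' B | 𝓗⟧ =ᵐ[P] K B)
    (hKA : ∀ B, ∀ ω ∈ A, K B ω = (κ (Y ω)).real B) :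
    (P.restrict A).map (fun ω => (Y ω, X ω)) = ((P.restrict A).map Y) ⊗ₘ κ := by
  have hYm : Measurable Y := hY.mono h𝓗 le_rfl
  refine Measure.ext_prod fun {C} {B} hC hB => ?_
  have hAC : MeasurableSet[𝓗] (A ∩ Y ⁻¹' C) := hA.inter (hY hC)
  have hYC : MeasurableSet (Y ⁻¹' C) := hYm hC
  rw [Measure.map_apply (hYm.prodMk hX) (hC.prod hB), Measure.compProd_apply_prod hC hB,
    setLIntegral_map hC (κ.measurable_coe hB) hYm, Measure.restrict_restrict hYC,
    Measure.restrict_apply ((hYm.prodMk hX) (hC.prod hB))]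
  have h1 := setIntegral_condExp h𝓗 (μ := P) (f := (X ⁻¹' B).indicator fun _ => (1 : ℝ))
    ((integrable_const _).indicator (hX hB)) hAC
  have h2 : ∫ ω in A ∩ Y ⁻¹' C, (P⟦X ⁻¹' B | 𝓗⟧) ω ∂P =
      ∫ ω in A ∩ Y ⁻¹' C, (κ (Y ω)).real B ∂P := by
    refine setIntegral_congr_ae (h𝓗 _ hAC) ?_
    filter_upwards [hK B hB] with ω hω hmem
    rw [hω, hKA B ω hmem.1]
  rw [h2, integral_indicator_const _ (hX hB), smul_eq_mul, mul_one] at h1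
  have h3 : ∫⁻ ω in Y ⁻¹' C ∩ A, κ (Y ω) B ∂P =
      ENNReal.ofReal (∫ ω in A ∩ Y ⁻¹' C, (κ (Y ω)).real B ∂P) := by
    rw [Set.inter_comm, ofReal_integral_eq_lintegral_ofReal]
    · refine lintegral_congr fun ω => ?_
      rw [measureReal_def, ENNReal.ofReal_toReal (measure_ne_top _ _)]
    · refine Integrable.of_bound (C := 1) ?_ (ae_of_all _ fun ω => ?_)
      · exact ((κ.measurable_coe hB).comp hYm).ennreal_toReal.aestronglyMeasurable
      · rw [Real.norm_of_nonneg measureReal_nonneg]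
        exact measureReal_le_one
    · exact ae_of_all _ fun ω => measureReal_nonneg
  rw [h3, h1, measureReal_def, ENNReal.ofReal_toReal (measure_ne_top _ _),
    Measure.restrict_apply (hX hB)]
  congr 1
  ext ω
  simp only [Set.mem_inter_iff, Set.mem_preimage, Set.mem_prod]
  tauto

instance (σ : ℝ≥0) : IsMarkovKernel (normalKernel σ) :=
  ⟨fun x => inferInstanceAs (IsProbabilityMeasure (gaussianReal x (σ ^ 2)))⟩

lemma integral_cexp_normalKernel (σ : ℝ≥0) (x c : ℝ) :
    ∫ y, Complex.exp (c * y * Complex.I) ∂normalKernel σ x =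
      Complex.exp (c * x * Complex.I - (σ : ℂ) ^ 2 * c ^ 2 / 2) := by
  rw [← charFun_apply_real]
  change charFun (gaussianReal x (σ ^ 2)) c = _
  rw [charFun_gaussianReal]
  push_cast
  rfl

/-- The variance of `∑ k ≤ m, c k * X k`, in units of `σ ^ 2`, in the tree `j`. -/
def quadForm (m : ℕ) (c : ℕ → ℝ) (j : Parents) : ℝ :=
  ∑ i ∈ Finset.range (m + 1), ∑ k ∈ Finset.range (m + 1), c i * c k * commonDepth j i k

lemma quadForm_zero (c : ℕ → ℝ) (j : Parents) : quadForm 0 c j = 0 := by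
  simp [quadForm, commonDepth_zero_right]

lemma quadForm_congr (m : ℕ) (c : ℕ → ℝ) {j j' : Parents} (h : ∀ i < m, j i = j' i) :
    quadForm m c j = quadForm m c j' := by
  refine Finset.sum_congr rfl fun i hi => Finset.sum_congr rfl fun k hk => ?_
  rw [commonDepth_congr h (by simpa [Nat.lt_succ_iff] using hi)
    (by simpa [Nat.lt_succ_iff] using hk)]

lemma quadForm_const (m : ℕ) (x : ℝ) (j : Parents) :
    quadForm m (fun _ => x) j = x ^ 2 * pathSum j (m + 1) := by
  rw [quadForm, pathSum_eq_sum]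
  push_cast
  simp only [Finset.mul_sum, sq]

/-- The last vertex can be merged into its parent. -/
lemma quadForm_succ (m : ℕ) (c : ℕ → ℝ) (j : Parents) :
    quadForm (m + 1) c j = c (m + 1) ^ 2 +
      quadForm m (fun k => c k + if k = j m then c (m + 1) else 0) j := by
  have hp : (j m : ℕ) ∈ Finset.range (m + 1) := Finset.mem_range.mpr (j m).isLt
  have h1 : ∀ i ∈ Finset.range (m + 1), commonDepth j i (m + 1) = commonDepth j i (j m) :=
    fun i hi => commonDepth_succ j (by simpa [Nat.lt_succ_iff] using hi)
  have hL : quadForm (m + 1) c j = quadForm m c j +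
      2 * c (m + 1) * ∑ i ∈ Finset.range (m + 1), c i * commonDepth j i (j m) +
      c (m + 1) ^ 2 * (depth j (j m) + 1) := by
    have h2 : ∑ i ∈ Finset.range (m + 1), c i * c (m + 1) * (commonDepth j i (m + 1) : ℝ) =
        c (m + 1) * ∑ i ∈ Finset.range (m + 1), c i * commonDepth j i (j m) := by
      rw [Finset.mul_sum]
      refine Finset.sum_congr rfl fun i hi => ?_
      rw [h1 i hi]
      ring
    have h3 : ∑ i ∈ Finset.range (m + 1), c (m + 1) * c i * (commonDepth j (m + 1) i : ℝ) =
        c (m + 1) * ∑ i ∈ Finset.range (m + 1), c i * commonDepth j i (j m) := by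
      rw [← h2]
      refine Finset.sum_congr rfl fun i hi => ?_
      rw [commonDepth_comm]
      ring
    rw [quadForm, Finset.sum_range_succ]
    simp only [Finset.sum_range_succ _ (m + 1), Finset.sum_add_distrib]
    rw [h2, h3, commonDepth_self, depth_succ, quadForm]
    push_cast
    ring
  have hR : quadForm m (fun k => c k + if k = j m then c (m + 1) else 0) j = quadForm m c j +
      2 * c (m + 1) * ∑ i ∈ Finset.range (m + 1), c i * commonDepth j i (j m) +
      c (m + 1) ^ 2 * depth j (j m) := by
    have e : ∀ i k : ℕ, (c i + if i = j m then c (m + 1) else 0) *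
        (c k + if k = j m then c (m + 1) else 0) * (commonDepth j i k : ℝ) =
        c i * c k * commonDepth j i k +
        (if k = j m then c (m + 1) * (c i * commonDepth j i k) else 0) +
        (if i = j m then c (m + 1) * (c k * commonDepth j k i) else 0) +
        (if i = j m then (if k = j m then c (m + 1) ^ 2 * commonDepth j i k else 0) else 0) := by
      intro i k
      rw [commonDepth_comm j k i]
      split_ifs <;> ring
    simp only [quadForm, e, Finset.sum_add_distrib]
    have e4 : ∑ i ∈ Finset.range (m + 1), ∑ k ∈ Finset.range (m + 1), (if i = (j m : ℕ) then
        (if k = (j m : ℕ) then c (m + 1) ^ 2 * (commonDepth j i k : ℝ) else 0) else 0) =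
        c (m + 1) ^ 2 * depth j (j m) := by
      rw [Finset.sum_eq_single_of_mem _ hp fun i _ hi => by simp [hi],
        Finset.sum_eq_single_of_mem _ hp fun i _ hi => by simp [hi]]
      simp [commonDepth_self]
    have e2 : ∑ i ∈ Finset.range (m + 1), ∑ k ∈ Finset.range (m + 1), (if k = (j m : ℕ) then
        c (m + 1) * (c i * (commonDepth j i k : ℝ)) else 0) =
        c (m + 1) * ∑ i ∈ Finset.range (m + 1), c i * commonDepth j i (j m) := by
      rw [Finset.mul_sum]
      refine Finset.sum_congr rfl fun i _ => ?_
      rw [Finset.sum_eq_single_of_mem _ hp fun k _ hk => by simp [hk]]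
      simp
    have e3 : ∑ i ∈ Finset.range (m + 1), ∑ k ∈ Finset.range (m + 1), (if i = (j m : ℕ) then
        c (m + 1) * (c k * (commonDepth j k i : ℝ)) else 0) =
        c (m + 1) * ∑ i ∈ Finset.range (m + 1), c i * commonDepth j i (j m) := by
      rw [Finset.sum_comm, e2]
    rw [e2, e3, e4]
    ring
  rw [hL, hR]
  ring

variable {Ω : Type*} {J : (m : ℕ) → Ω → Fin (m + 1)} {X : ℕ → Ω → ℝ}

lemma measurable_history_X {n i : ℕ} (h : i ≤ n) : Measurable[history J X n] (X i) := by
  refine measurable_iff_comap_le.mpr (le_trans ?_ le_sup_left)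
  exact le_iSup₂_of_le (f := fun i (_ : i ∈ Set.Iic n) =>
    MeasurableSpace.comap (X i) inferInstance) i h le_rfl

lemma measurable_history_J {n m : ℕ} (h : m < n) : Measurable[history J X n] (J m) := by
  refine measurable_iff_comap_le.mpr (le_trans ?_ le_sup_right)
  exact le_iSup₂_of_le (f := fun m (_ : m ∈ Set.Iio n) =>
    MeasurableSpace.comap (J m) inferInstance) m h le_rfl

/-- The event that the parents of the vertices `1, …, m` are those of `j`. -/
def cylinder (J : (m : ℕ) → Ω → Fin (m + 1)) (m : ℕ) (j : Parents) : Set Ω :=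
  {ω | ∀ i < m, J i ω = j i}

lemma cylinder_succ (m : ℕ) (j : Parents) :
    cylinder J (m + 1) j = J m ⁻¹' {j m} ∩ cylinder J m j := by
  ext ω
  simp only [cylinder, Set.mem_inter_iff, Set.mem_preimage, Set.mem_singleton_iff,
    Set.mem_ofPred_eq]
  constructor
  · exact fun h => ⟨h m (by omega), fun i hi => h i (by omega)⟩
  · rintro ⟨h1, h2⟩ i hi
    rcases Nat.lt_succ_iff_lt_or_eq.mp hi with h | rfl
    · exact h2 i h
    · exact h1

lemma measurableSet_cylinder {n m : ℕ} (h : m ≤ n) (j : Parents) :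
    MeasurableSet[history J X n] (cylinder J m j) := by
  have : cylinder J m j = ⋂ i ∈ Set.Iio m, J i ⁻¹' {j i} := by
    ext ω
    simp [cylinder]
  rw [this]
  exact MeasurableSet.biInter (Set.to_countable _) fun i hi =>
    measurable_history_J (lt_of_lt_of_le hi h) (measurableSet_singleton _)

variable [mΩ : MeasurableSpace Ω]

lemma IsRecursiveSet.history_le {θ : ℝ} {κ : Kernel ℝ ℝ} {P : Measure Ω}
    (h : IsRecursiveSet θ κ J X P) (n : ℕ) : history J X n ≤ mΩ :=
  sup_le (iSup₂_le fun i _ => (h.measurable i).comap_le)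
    (iSup₂_le fun m _ => (h.isHoppe.measurable m).comap_le)

/-- The parent of the vertex `m + 1` is independent of the past. -/
lemma IsRecursiveSet.setIntegral_cylinder_succ {θ : ℝ} {κ : Kernel ℝ ℝ} {P : Measure Ω}
    (h : IsRecursiveSet θ κ J X P) (j : Parents) (m : ℕ) {f : Ω → ℂ}
    (hf : Measurable[history J X m] f) :
    ∫ ω in cylinder J (m + 1) j, f ω ∂P =
      P.real (J m ⁻¹' {j m}) * ∫ ω in cylinder J m j, f ω ∂P := by
  have hle := h.history_le m
  have hJ := h.isHoppe.measurable m
  have hcyl : MeasurableSet[history J X m] (cylinder J m j) := measurableSet_cylinder le_rfl j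
  have hB : MeasurableSet[MeasurableSpace.comap (J m) inferInstance] (J m ⁻¹' {j m}) :=
    ⟨{j m}, measurableSet_singleton _, rfl⟩
  have hB' : MeasurableSet (J m ⁻¹' {j m}) := hJ (measurableSet_singleton _)
  have hf1 : Measurable[MeasurableSpace.comap (J m) inferInstance]
      ((J m ⁻¹' {j m}).indicator fun _ => (1 : ℂ)) := measurable_const.indicator hB
  have hf2 : Measurable[history J X m] ((cylinder J m j).indicator f) := hf.indicator hcyl
  have hI : IndepFun ((J m ⁻¹' {j m}).indicator fun _ => (1 : ℂ))
      ((cylinder J m j).indicator f) P :=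
    (IndepFun_iff_Indep _ _ _).mpr (indep_of_indep_of_le_left
      (indep_of_indep_of_le_right (h.indep m) hf2.comap_le) hf1.comap_le)
  have hmul := hI.integral_fun_mul_eq_mul_integral
    (hf1.mono hJ.comap_le le_rfl).aestronglyMeasurable
    (hf2.mono hle le_rfl).aestronglyMeasurable
  rw [integral_indicator (hle _ hcyl), integral_indicator_const _ hB', Complex.real_smul,
    mul_one] at hmul
  rw [← hmul, cylinder_succ, ← integral_indicator (hB'.inter (hle _ hcyl))]
  congr 1
  funext ω
  by_cases h1 : ω ∈ J m ⁻¹' {j m} <;> by_cases h2 : ω ∈ cylinder J m j <;>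
    simp [Set.indicator, h1, h2]

/-- Given the tree, a linear combination of the positions is centred normal. -/
lemma IsRecursiveSet.setIntegral_cexp {θ : ℝ} {σ : ℝ≥0} {P : Measure Ω} [IsProbabilityMeasure P]
    (h : IsRecursiveSet θ (normalKernel σ) J X P) (j : Parents) (m : ℕ) (c : ℕ → ℝ) :
    ∫ ω in cylinder J m j,
      Complex.exp ((∑ k ∈ Finset.range (m + 1), c k * X k ω : ℝ) * Complex.I) ∂P =
    P.real (cylinder J m j) * Complex.exp ((-((σ : ℝ) ^ 2 / 2 * quadForm m c j) : ℝ)) := by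
  induction m generalizing c with
  | zero =>
    have hu : cylinder J 0 j = Set.univ := by simp [cylinder]
    have h0 : ∀ᵐ ω ∂P, Complex.exp ((∑ k ∈ Finset.range (0 + 1), c k * X k ω : ℝ) * Complex.I) =
        1 := by
      filter_upwards [h.zero] with ω hω
      simp [hω]
    rw [hu, setIntegral_univ, integral_congr_ae h0, quadForm_zero]
    simp
  | succ m ih =>
    have hle := h.history_le m
    have hJ := h.isHoppe.measurable m
    obtain ⟨p, hp⟩ : ∃ p : ℕ, p = (j m : ℕ) := ⟨_, rfl⟩
    set c' : ℕ → ℝ := fun k => c k + if k = j m then c (m + 1) else 0 with hc'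
    have h𝓗 : history J X m ⊔ MeasurableSpace.comap (J m) inferInstance ≤ mΩ := sup_le hle hJ.comap_le
    have hsub : history J X m ≤ history J X m ⊔ MeasurableSpace.comap (J m) inferInstance := le_sup_left
    have hJ𝓗 : Measurable[
        history J X m ⊔ MeasurableSpace.comap (J m) inferInstance] (J m) := measurable_iff_comap_le.mpr le_sup_right
    set A := cylinder J (m + 1) j with hA
    have hAm : MeasurableSet[
        history J X m ⊔ MeasurableSpace.comap (J m) inferInstance] A := by
      rw [hA, cylinder_succ]
      exact (hJ𝓗 (measurableSet_singleton _)).inter (hsub _ (measurableSet_cylinder le_rfl j))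
    have hpm : p ≤ m := hp ▸ Nat.lt_succ_iff.mp (j m).isLt
    set W : Ω → ℝ := fun ω => ∑ k ∈ Finset.range (m + 1), c k * X k ω with hW
    have hWm : Measurable[history J X m] W :=
      Finset.measurable_sum _ fun k hk => (measurable_history_X
        (by simpa [Nat.lt_succ_iff] using hk)).const_mul (c k)
    set Y : Ω → ℝ × ℝ := fun ω => (W ω, X p ω) with hY
    have hYm : Measurable[
        history J X m ⊔ MeasurableSpace.comap (J m) inferInstance] Y :=
      Measurable.prodMk (hWm.mono hsub le_rfl) ((measurable_history_X hpm).mono hsub le_rfl)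
    have hlaw := map_restrict_eq_compProd h𝓗 hAm hYm (h.measurable (m + 1))
      (κ := (normalKernel σ).comap Prod.snd measurable_snd) (h.condDistrib m) (by
        intro B ω hω
        have hω' : J m ω = j m := by
          rw [hA, cylinder_succ] at hω
          exact hω.1
        rw [Kernel.comap_apply, hω', hY, hp])
    have hYmeas : Measurable Y := hYm.mono h𝓗 le_rfl
    set g : (ℝ × ℝ) × ℝ → ℂ := fun z =>
      Complex.exp (z.1.1 * Complex.I) * Complex.exp (c (m + 1) * z.2 * Complex.I) with hg
    have hgm : Measurable g := by fun_prop
    have hgb : ∀ z, ‖g z‖ ≤ 1 := fun z => by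
      simp only [hg]
      rw [norm_mul, Complex.norm_exp_ofReal_mul_I, ← Complex.ofReal_mul,
        Complex.norm_exp_ofReal_mul_I, one_mul]
    have e1 : ∫ ω in A,
        Complex.exp ((∑ k ∈ Finset.range (m + 1 + 1), c k * X k ω : ℝ) * Complex.I) ∂P =
        ∫ ω in A, g (Y ω, X (m + 1) ω) ∂P := by
      congr 1
      funext ω
      simp only [hg, hY, hW]
      rw [Finset.sum_range_succ, ← Complex.exp_add]
      congr 1
      push_cast
      ring
    have e2 : ∫ ω in A, g (Y ω, X (m + 1) ω) ∂P =
        ∫ ω in A, (∫ x, g (Y ω, x) ∂normalKernel σ (X p ω)) ∂P := by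
      have hi : Integrable g (((P.restrict A).map Y) ⊗ₘ
          (normalKernel σ).comap Prod.snd measurable_snd) :=
        Integrable.of_bound (C := 1) hgm.aestronglyMeasurable (ae_of_all _ hgb)
      rw [← integral_map (φ := fun ω => (Y ω, X (m + 1) ω)) (f := g)
        (hYmeas.prodMk (h.measurable (m + 1))).aemeasurable hgm.aestronglyMeasurable, hlaw,
        Measure.integral_compProd hi, integral_map hYmeas.aemeasurable
          (by exact hi.integral_compProd.aestronglyMeasurable)]
      rfl
    have e3 : ∀ ω, ∫ x, g (Y ω, x) ∂normalKernel σ (X p ω) =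
        Complex.exp ((-((σ : ℝ) ^ 2 / 2 * c (m + 1) ^ 2) : ℝ)) *
        Complex.exp ((∑ k ∈ Finset.range (m + 1), c' k * X k ω : ℝ) * Complex.I) := by
      intro ω
      have hsum : ∑ k ∈ Finset.range (m + 1), c' k * X k ω = W ω + c (m + 1) * X p ω := by
        simp only [hc', ← hp, add_mul, Finset.sum_add_distrib, hW]
        congr 1
        rw [Finset.sum_eq_single_of_mem p (Finset.mem_range.mpr (Nat.lt_succ_of_le hpm))
          fun k _ hk => by rw [if_neg hk, zero_mul], if_pos rfl]
      simp only [hg]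
      rw [integral_const_mul, integral_cexp_normalKernel, hsum, ← Complex.exp_add,
        ← Complex.exp_add]
      congr 1
      push_cast
      ring
    have hreal : P.real A = P.real (J m ⁻¹' {j m}) * P.real (cylinder J m j) := by
      have h1 := h.setIntegral_cylinder_succ j m (f := fun _ => (1 : ℂ)) measurable_const
      simp only [integral_const, measureReal_restrict_apply_univ, Complex.real_smul, mul_one]
        at h1
      exact_mod_cast h1
    have hmeas : Measurable[history J X m] fun ω =>
        Complex.exp ((∑ k ∈ Finset.range (m + 1), c' k * X k ω : ℝ) * Complex.I) :=
      (show Measurable fun x : ℝ => Complex.exp (x * Complex.I) by fun_prop).comp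
        (Finset.measurable_sum _ fun k hk => (measurable_history_X
          (by simpa [Nat.lt_succ_iff] using hk)).const_mul (c' k))
    rw [e1, e2]
    simp only [e3]
    rw [integral_const_mul, h.setIntegral_cylinder_succ j m hmeas, ih, hreal, quadForm_succ,
      mul_add, neg_add, Complex.ofReal_add, Complex.exp_add]
    push_cast
    ring

end Barycentre

section Assembly

open Topology

variable {Ω : Type*} {J : (m : ℕ) → Ω → Fin (m + 1)}

lemma mem_cylinder_extend {m : ℕ} {y : (i : Finset.range m) → Fin ((i : ℕ) + 1)} {ω : Ω} :
    ω ∈ cylinder J m (extend (Finset.range m) y) ↔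
      y = (Finset.range m).restrict fun i => J i ω := by
  simp only [cylinder, Set.mem_ofPred_eq]
  constructor
  · intro h
    funext i
    have := h i (Finset.mem_range.mp i.2)
    rw [extend, dif_pos i.2] at this
    exact this.symm
  · rintro rfl i hi
    rw [extend, dif_pos (Finset.mem_range.mpr hi)]
    rfl

variable [MeasurableSpace Ω] {P : Measure Ω}

/-- The law of total probability for the shape of the tree on `0, …, m`. -/
lemma integral_eq_sum_cylinder (hJ : ∀ m, Measurable (J m)) (m : ℕ) {f : Ω → ℂ}
    (hf : Integrable f P) : ∫ ω, f ω ∂P = ∑ y : (i : Finset.range m) → Fin ((i : ℕ) + 1),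
      ∫ ω in cylinder J m (extend (Finset.range m) y), f ω ∂P := by
  have hmeas : ∀ j, MeasurableSet (cylinder J m j) := fun j => by
    have : cylinder J m j = ⋂ i ∈ Set.Iio m, J i ⁻¹' {j i} := by
      ext ω
      simp [cylinder]
    rw [this]
    exact MeasurableSet.biInter (Set.to_countable _) fun i _ => hJ i (measurableSet_singleton _)
  simp only [← integral_indicator (hmeas _)]
  rw [← integral_finsetSum _ fun y _ => hf.indicator (hmeas _)]
  congr 1
  funext ω
  rw [Finset.sum_eq_single ((Finset.range m).restrict fun i => J i ω)]
  · rw [Set.indicator_of_mem (mem_cylinder_extend.mpr rfl)]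
  · intro y _ hy
    rw [Set.indicator_of_notMem fun h => hy (mem_cylinder_extend.mp h)]
  · simp

lemma IsRecursiveSet.integral_cexp [IsProbabilityMeasure P] {θ : ℝ} {σ : ℝ≥0} {X : ℕ → Ω → ℝ}
    (h : IsRecursiveSet θ (normalKernel σ) J X P) (m : ℕ) (c : ℕ → ℝ) :
    ∫ ω, Complex.exp ((∑ k ∈ Finset.range (m + 1), c k * X k ω : ℝ) * Complex.I) ∂P =
      ∫ ω, Complex.exp ((-((σ : ℝ) ^ 2 / 2 * quadForm m c fun i => J i ω) : ℝ)) ∂P := by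
  have hX := h.measurable
  have hJ := h.isHoppe.measurable
  have hdep : DependsOn (fun j => Complex.exp ((-((σ : ℝ) ^ 2 / 2 * quadForm m c j) : ℝ)))
      (Set.Iio m) := fun j j' hj => by simp only [quadForm_congr m c hj]
  obtain ⟨C, hC⟩ := exists_bound_of_dependsOn hdep
  have i1 : Integrable (fun ω => Complex.exp
      ((∑ k ∈ Finset.range (m + 1), c k * X k ω : ℝ) * Complex.I)) P := by
    refine Integrable.of_bound (C := 1) (by fun_prop) (ae_of_all _ fun ω => ?_)
    exact (Complex.norm_exp_ofReal_mul_I _).le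
  have i2 : Integrable (fun ω => Complex.exp
      ((-((σ : ℝ) ^ 2 / 2 * quadForm m c fun i => J i ω) : ℝ))) P :=
    Integrable.of_bound (C := C) ((measurable_of_dependsOn hdep).comp
      h.isHoppe.measurable_parents).aestronglyMeasurable (ae_of_all _ fun ω => hC _)
  rw [integral_eq_sum_cylinder hJ m i1, integral_eq_sum_cylinder hJ m i2]
  refine Finset.sum_congr rfl fun y _ => ?_
  set j := extend (Finset.range m) y
  have hcyl : MeasurableSet (cylinder J m j) :=
    h.history_le m _ (measurableSet_cylinder le_rfl j)
  rw [h.setIntegral_cexp, setIntegral_congr_fun (g := fun _ =>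
    Complex.exp ((-((σ : ℝ) ^ 2 / 2 * quadForm m c j) : ℝ))) hcyl fun ω hω => ?_]
  · rw [setIntegral_const, Complex.real_smul]
  · simp only
    rw [quadForm_congr m c hω]

lemma IsHoppe.map_scaledSum [IsProbabilityMeasure P] {θ : ℝ} (h : IsHoppe θ J P) (n : ℕ) :
    P.map (fun ω => scaledSum n fun m => J m ω) = (hoppeMeasure θ).map (scaledSum n) := by
  rw [← h.map_eq, Measure.map_map (measurable_scaledSum n) h.measurable_parents]
  rfl

lemma IsHoppe.tendstoInDistribution [IsProbabilityMeasure P] {θ : ℝ} (h : IsHoppe θ J P)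
    {μ : Measure ℝ} [IsProbabilityMeasure μ] (hμ : IsLimitLaw θ μ) :
    TendstoInDistribution (fun n ω => scaledSum n fun m => J m ω) atTop id (fun _ => P) μ := by
  refine ⟨fun n => ((measurable_scaledSum n).comp h.measurable_parents).aemeasurable,
    aemeasurable_id, ProbabilityMeasure.tendsto_of_tendsto_charFun fun s => ?_⟩
  simp only [ProbabilityMeasure.coe_mk, Measure.map_id]
  refine (hμ.tendsto_charFun s).congr fun n => ?_
  rw [← h.map_scaledSum n]

lemma charFun_mixedNormal (ρ : Measure ℝ) [IsProbabilityMeasure ρ] (s : ℝ) :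
    charFun (mixedNormal ρ) s = ∫ v, Complex.exp ((-(v.toNNReal * s ^ 2 / 2) : ℝ)) ∂ρ := by
  have hm : Measurable fun x : ℝ => Complex.exp (s * x * Complex.I) := by fun_prop
  have hi : Integrable (fun p : ℝ × ℝ => Complex.exp (s * p.2 * Complex.I))
      (ρ ⊗ₘ centredNormalKernel) :=
    Integrable.of_bound (C := 1) (hm.comp measurable_snd).aestronglyMeasurable
      (ae_of_all _ fun p => by rw [← Complex.ofReal_mul, Complex.norm_exp_ofReal_mul_I])
  rw [charFun_apply_real, mixedNormal, ← Measure.snd_compProd, Measure.snd,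
    integral_map measurable_snd.aemeasurable hm.aestronglyMeasurable,
    Measure.integral_compProd hi]
  refine integral_congr_ae (ae_of_all _ fun v => ?_)
  simp only
  rw [← charFun_apply_real]
  change charFun (gaussianReal 0 v.toNNReal) s = _
  rw [charFun_gaussianReal]
  congr 1
  push_cast
  ring

lemma IsRecursiveSet.charFun_barycentre [IsProbabilityMeasure P] {θ : ℝ} {σ : ℝ≥0}
    {X : ℕ → Ω → ℝ} (h : IsRecursiveSet θ (normalKernel σ) J X P) (m : ℕ) (s : ℝ) :
    charFun (P.map (barycentre X (m + 1))) s = ∫ ω, Complex.exp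
      ((-((σ : ℝ) ^ 2 * s ^ 2 / 2 * scaledSum (m + 1) fun i => J i ω) : ℝ)) ∂P := by
  have hX := h.measurable
  have hb : Measurable (barycentre X (m + 1)) := by unfold barycentre; fun_prop
  rw [charFun_apply_real, integral_map hb.aemeasurable (by fun_prop)]
  have h1 := h.integral_cexp m fun _ => s / (m + 1)
  simp only [quadForm_const] at h1
  have e1 : ∀ ω, Complex.exp (s * barycentre X (m + 1) ω * Complex.I) =
      Complex.exp ((∑ k ∈ Finset.range (m + 1), s / ((m : ℝ) + 1) * X k ω : ℝ) * Complex.I) := by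
    intro ω
    rw [barycentre, ← Finset.mul_sum, ← Complex.ofReal_mul]
    congr 3
    push_cast
    ring
  simp only [e1]
  rw [h1]
  congr 1
  funext ω
  rw [scaledSum]
  congr 2
  push_cast
  field_simp

lemma IsRecursiveSet.tendstoInDistribution_barycentre [IsProbabilityMeasure P] {θ : ℝ}
    {σ : ℝ≥0} {X : ℕ → Ω → ℝ} (h : IsRecursiveSet θ (normalKernel σ) J X P) {μ : Measure ℝ}
    [IsProbabilityMeasure μ] (hμ : IsLimitLaw θ μ) (hnn : ∀ᵐ u ∂μ, 0 ≤ u) {ρ : Measure ℝ}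
    [IsProbabilityMeasure ρ] (hρ : ρ = μ.map fun u => (σ : ℝ) ^ 2 * u) :
    TendstoInDistribution (barycentre X) atTop id (fun _ => P) (mixedNormal ρ) := by
  have hX := h.measurable
  have hb : ∀ n, Measurable (barycentre X n) := fun n => by unfold barycentre; fun_prop
  refine ⟨fun n => (hb n).aemeasurable, aemeasurable_id,
    ProbabilityMeasure.tendsto_of_tendsto_charFun fun s => ?_⟩
  simp only [ProbabilityMeasure.coe_mk, Measure.map_id]
  rw [← tendsto_add_atTop_iff_nat 1]
  simp only [h.charFun_barycentre]
  set a : ℝ := (σ : ℝ) ^ 2 * s ^ 2 / 2 with ha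
  have ha0 : 0 ≤ a := by positivity
  let f : BoundedContinuousFunction ℝ ℝ := BoundedContinuousFunction.ofNormedAddCommGroup
    (fun u => Real.exp (-(a * |u|))) (by fun_prop) 1 (fun u => by
      rw [Real.norm_of_nonneg (Real.exp_pos _).le, Real.exp_le_one_iff]
      have : 0 ≤ a * |u| := by positivity
      linarith)
  have hd := h.isHoppe.tendstoInDistribution hμ
  have hf := (ProbabilityMeasure.tendsto_iff_forall_integral_tendsto.mp hd.tendsto) f
  have hf2 := (tendsto_add_atTop_iff_nat 1).mpr hf
  simp only [ProbabilityMeasure.coe_mk, Measure.map_id] at hf2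
  have hc := (Complex.continuous_ofReal.tendsto _).comp hf2
  have elim : charFun (mixedNormal ρ) s = ((∫ u, f u ∂μ : ℝ) : ℂ) := by
    rw [charFun_mixedNormal, hρ, integral_map (by fun_prop) (by fun_prop), ← integral_complex_ofReal]
    refine integral_congr_ae ?_
    filter_upwards [hnn] with u hu
    rw [Real.coe_toNNReal _ (by positivity)]
    change _ = ((Real.exp (-(a * |u|)) : ℝ) : ℂ)
    rw [abs_of_nonneg hu, Complex.ofReal_exp, ha]
    congr 2
    ring
  rw [elim]
  refine hc.congr fun m => ?_
  simp only [Function.comp_apply]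
  rw [integral_map (hd.forall_aemeasurable (m + 1))
    f.continuous.aestronglyMeasurable, ← integral_complex_ofReal]
  congr 1
  funext ω
  change ((Real.exp (-(a * |_|)) : ℝ) : ℂ) = _
  rw [abs_of_nonneg (scaledSum_nonneg _ _), Complex.ofReal_exp]

lemma variance_scaled {θ : ℝ} (hθ : 0 < θ) {σ : ℝ} {μ : Measure ℝ} [IsProbabilityMeasure μ]
    (hμ : MemLp id 2 μ) (h1 : ∫ u, u ∂μ = 2 / (1 + θ))
    (h2 : ∫ u, u ^ 2 ∂μ = (12 * θ + 76) / (3 * (1 + θ) * (2 + θ) * (3 + θ))) :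
    Var[id; μ.map fun u => σ ^ 2 * u] =
      (28 * θ + 4) / (3 * (1 + θ) ^ 2 * (2 + θ) * (3 + θ)) * σ ^ 4 := by
  rw [variance_map aemeasurable_id (by fun_prop)]
  change Var[fun u => σ ^ 2 * id u; μ] = _
  rw [variance_const_mul, variance_eq_sub hμ]
  simp only [id_eq, Pi.pow_apply]
  rw [h1, h2]
  field_simp
  ring

end Assembly

end HoppeTree

end

theorem mainTheorem2 :
    -- `U_n = n T_n - W_n`
    (∀ (j : HoppeTree.Parents) (n : ℕ), (HoppeTree.pathSum j n : ℝ) =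
      n * HoppeTree.totalLength j n - HoppeTree.wienerIndex j n) ∧
    -- the law `μ` of the limit `U` for the random recursive tree
    ∃ (μ : Measure ℝ) (_ : IsProbabilityMeasure μ),
      (∀ (Ω : Type u) [MeasurableSpace Ω] (P : Measure Ω) [IsProbabilityMeasure P]
        (J : (m : ℕ) → Ω → Fin (m + 1)), HoppeTree.IsHoppe 1 J P →
        TendstoInDistribution
          (fun (n : ℕ) ω => (HoppeTree.pathSum (fun m => J m ω) n : ℝ) / (n : ℝ) ^ 2)
          atTop id (fun _ => P) μ) ∧
      HoppeTree.IsRecursiveFixpoint μ ∧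
      MemLp id 2 μ ∧ ∫ u, u ∂μ = 1 ∧ ∫ u, u ^ 2 ∂μ = 11 / 9 ∧
      -- the law `μ'` of the limit `U'` for the Hoppe tree
      ∀ θ : ℝ, 0 < θ → ∃ (μ' : Measure ℝ) (_ : IsProbabilityMeasure μ'),
        (∀ (Ω : Type u) [MeasurableSpace Ω] (P : Measure Ω) [IsProbabilityMeasure P]
          (J : (m : ℕ) → Ω → Fin (m + 1)), HoppeTree.IsHoppe θ J P →
          TendstoInDistribution
            (fun (n : ℕ) ω => (HoppeTree.pathSum (fun m => J m ω) n : ℝ) / (n : ℝ) ^ 2)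
            atTop id (fun _ => P) μ') ∧
        HoppeTree.IsHoppeFixpoint θ μ μ' ∧
        MemLp id 2 μ' ∧
        ∫ u, u ∂μ' = 2 / (1 + θ) ∧
        ∫ u, u ^ 2 ∂μ' = (12 * θ + 76) / (3 * (1 + θ) * (2 + θ) * (3 + θ)) ∧
        -- the barycentre for normal jumps: the random variance has the law `ρ` of `σ² U'`
        ∀ σ : ℝ≥0, 0 < σ → ∃ (ρ : Measure ℝ) (_ : IsProbabilityMeasure ρ),
          ρ = μ'.map (fun u => (σ : ℝ) ^ 2 * u) ∧
          (∀ᵐ v ∂ρ, 0 ≤ v) ∧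
          MemLp id 2 ρ ∧
          ∫ v, v ∂ρ = 2 / (1 + θ) * (σ : ℝ) ^ 2 ∧
          Var[id; ρ] =
            (28 * θ + 4) / (3 * (1 + θ) ^ 2 * (2 + θ) * (3 + θ)) * (σ : ℝ) ^ 4 ∧
          ∀ (Ω : Type u) [MeasurableSpace Ω] (P : Measure Ω) [IsProbabilityMeasure P]
            (J : (m : ℕ) → Ω → Fin (m + 1)) (X : ℕ → Ω → ℝ),
            HoppeTree.IsRecursiveSet θ (HoppeTree.normalKernel σ) J X P →
            TendstoInDistribution (HoppeTree.barycentre X) atTop id (fun _ => P)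
              (HoppeTree.mixedNormal ρ) := by
  refine ⟨fun j n => ?_, ?_⟩
  · have := HoppeTree.pathSum_add_wienerIndex j n
    rw [eq_sub_iff_add_eq]
    exact_mod_cast this
  obtain ⟨μ, hμp, hμ, hμ2, hμ1, -⟩ := HoppeTree.exists_isLimitLaw one_pos
  have hfix := HoppeTree.isHoppeFixpoint_of_isLimitLaw one_pos hμ hμ
  have hmean : ∫ u, u ∂μ = 1 := by rw [hμ1]; norm_num
  have hsq := HoppeTree.integral_sq_of_isRecursive hfix hμ2 hmean
  refine ⟨μ, hμp, fun Ω _ P _ J hJ => hJ.tendstoInDistribution hμ,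
    HoppeTree.isRecursiveFixpoint_of_isLimitLaw hμ, hμ2, hmean, hsq, fun θ hθ => ?_⟩
  obtain ⟨μ', hμp', hμ', hμ2', hμ1', hnn⟩ := HoppeTree.exists_isLimitLaw hθ
  have hfix' := HoppeTree.isHoppeFixpoint_of_isLimitLaw hθ hμ hμ'
  have hsq' := HoppeTree.integral_sq_of_isHoppe hθ hfix' hμ2 hμ2' hmean hsq hμ1'
  refine ⟨μ', hμp', fun Ω _ P _ J hJ => hJ.tendstoInDistribution hμ', hfix', hμ2', hμ1', hsq',
    fun σ _ => ?_⟩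
  have hm : Measurable fun u : ℝ => (σ : ℝ) ^ 2 * u := by fun_prop
  have hρp : IsProbabilityMeasure (μ'.map fun u => (σ : ℝ) ^ 2 * u) :=
    Measure.isProbabilityMeasure_map hm.aemeasurable
  refine ⟨μ'.map fun u => (σ : ℝ) ^ 2 * u, hρp, rfl, ?_, ?_, ?_, ?_, ?_⟩
  · rw [ae_map_iff hm.aemeasurable measurableSet_Ici]
    filter_upwards [hnn] with u hu
    positivity
  · rw [memLp_map_measure_iff (by fun_prop) hm.aemeasurable]
    exact hμ2'.const_mul _
  · rw [integral_map hm.aemeasurable (by fun_prop), integral_const_mul, hμ1', mul_comm]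
  · exact HoppeTree.variance_scaled hθ hμ2' hμ1' hsq'
  · exact fun Ω _ P _ J X h => h.tendstoInDistribution_barycentre hμ' hnn rfl
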